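/- A link diagram $T$ is a finite multigraph embedded in the interior of a disk, considered up to isotopy, each of whose vertices is either quadrivalent (a crossing, with one opposite pair of half-edges marked "over") or a bivalent marking point; every crossingless loop carries at least one marking point. Let $n_T$ be the number of crossings of $T$ and $c_T$ the number of connected components of the underlying graph. There is a unique assignment $T\mapsto [T]\in\mathbb{Z}[A,A^{-1}]$ of a Laurent polynomial to every link diagram (the positive Kauffman bracket polynomial, where $[T]$ is the coefficient of the empty diagram) such that (i) $[\emptyset]=1$; (ii) $[T]=(A^2+A^{-2})\,[T']$ whenever $T'$ is obtained from $T$ by deleting a crossingless loop that bounds a disk whose interior does not meet $T$; (iii) $[T]=A\,[T_A]+A^{-1}\,[T_B]$ whenever $T_A$ and $T_B$ are obtained from $T$ by the $A$-smoothing and the $B$-smoothing of one crossing, where the $A$-smoothing joins the two corners swept out by turning the over-strand counterclockwise and the $B$-smoothing joins the two other corners. For every link diagram $T$ the polynomial $[T]$ is nonzero, and its total span, i.e. the highest power of $A$ occurring in $[T]$ minus the lowest power, satisfies $$\operatorname{totalspan}[T]\le 4(n_T+c_T).$$ -/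

import Mathlib

/-- A link diagram: a finite multigraph embedded in the interior of an oriented disk, all of whose
vertices are crossings (quadrivalent, with one opposite pair of half-edges marked "over") or
bivalent marking points, up to isotopy. Bivalent points may lie anywhere on an edge or loop; every
crossingless loop carries at least one. The embedding is recorded by

* the half-edges ("darts", each pointing away from its vertex),
* the rotation `rot` (next dart counterclockwise at the same vertex), so that vertices are the
  orbits of `rot`, of size 2 or 4,
* the involution `opp` (the other half of the same edge),
* the set `Region` of all regions of the complement of the graph in the disk, the region `outer`
  that touches the boundary circle, and for each dart `d` the region `region d` lying to the left
  of `d`, i.e. in the corner between `d` and `rot d`.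

A region may be bounded by several connected components of the graph, so the relative position of
the components in the disk is part of the data. Planarity is the conjunction of
`connected`, which says that any two regions are joined by a path crossing edges, and `euler`,
which is Euler's formula `V - E + R = 1 + C` for plane graphs with `C` connected components. (For
data satisfying the other axioms, `V - E + R = 1 + C` holds iff every component has genus `0` and
components and regions, joined along boundary curves, form a tree.) -/
structure LinkDiagram where
  Dart : Type
  finite_dart : Finite Dart
  rot : Equiv.Perm Dart
  opp : Equiv.Perm Dart
  rot_ne : ∀ d, rot d ≠ d
  rot_four : ∀ d, rot (rot (rot (rot d))) = d
  opp_ne : ∀ d, opp d ≠ d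
  opp_opp : ∀ d, opp (opp d) = d
  /-- the darts of the over-strand at a crossing; without meaning at bivalent vertices -/
  overDarts : Set Dart
  overDarts_rot : ∀ d, rot (rot d) ≠ d → (rot d ∈ overDarts ↔ d ∉ overDarts)
  Region : Type
  finite_region : Finite Region
  outer : Region
  region : Dart → Region
  /-- The corner between `d` and `rot d` is to the right of `rot d`, hence to the left of the
  oppositely directed dart `opp (rot d)`. -/
  region_face : ∀ d, region (opp (rot d)) = region d
  connected : ∀ r s, Relation.ReflTransGen (fun r s => ∃ d, region d = r ∧ region (opp d) = s) r s
  euler : Nat.card (Quot fun a b => b = rot a) + Nat.card Region =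
    Nat.card (Quot fun a b => b = opp a) + Nat.card (Quot fun a b => b = rot a ∨ b = opp a) + 1

namespace LinkDiagram

/-- The vertices: crossings and bivalent points. -/
def Vertex (D : LinkDiagram) : Type := Quot fun a b => b = D.rot a

/-- The connected components of the underlying graph. -/
def Component (D : LinkDiagram) : Type := Quot fun a b => b = D.rot a ∨ b = D.opp a

/-- `d` is a half-edge at a crossing (a quadrivalent vertex). -/
def AtCrossing (D : LinkDiagram) (d : D.Dart) : Prop := D.rot (D.rot d) ≠ d

/-- `n_T`, the number of crossings. -/
noncomputable def numCrossings (D : LinkDiagram) : ℕ :=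
  Nat.card {v : D.Vertex // ∃ d, D.AtCrossing d ∧ Quot.mk _ d = v}

/-- `c_T`, the number of connected components of the diagram (as a subset of the disk). -/
noncomputable def numComponents (D : LinkDiagram) : ℕ := Nat.card D.Component

/-- `D'` is obtained from `D` by smoothing the crossing with darts (counterclockwise)
`e`, `rot e`, `rot² e`, `rot³ e` so that the opposite corners between `e` and `rot e` and between
`rot² e` and `rot³ e` are joined by a channel: the crossing is replaced by two arcs, one joining
`rot³ e` to `e` and one joining `rot e` to `rot² e` (each carrying a bivalent point), the
regions of those two corners become one, and nothing else changes. -/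
def IsSmoothing (D D' : LinkDiagram) (e : D.Dart) : Prop :=
  D.AtCrossing e ∧
  ∃ (f : D.Dart ≃ D'.Dart) (q : D.Region → D'.Region),
    (∀ d, D'.opp (f d) = f (D.opp d)) ∧
    D'.rot (f e) = f (D.rot (D.rot (D.rot e))) ∧
    D'.rot (f (D.rot (D.rot (D.rot e)))) = f e ∧
    D'.rot (f (D.rot e)) = f (D.rot (D.rot e)) ∧
    D'.rot (f (D.rot (D.rot e))) = f (D.rot e) ∧
    (∀ d, d ≠ e → d ≠ D.rot e → d ≠ D.rot (D.rot e) → d ≠ D.rot (D.rot (D.rot e)) →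
      D'.rot (f d) = f (D.rot d) ∧ (D.AtCrossing d → (f d ∈ D'.overDarts ↔ d ∈ D.overDarts))) ∧
    (∀ d, D'.region (f d) = q (D.region d)) ∧
    q D.outer = D'.outer ∧
    Function.Surjective q ∧
    (∀ r s, q r = q s ↔ r = s ∨
      (r = D.region e ∧ s = D.region (D.rot (D.rot e))) ∨
      (r = D.region (D.rot (D.rot e)) ∧ s = D.region e))

/-- `D'` is obtained from `D` by deleting a crossingless loop together with one region
other than the outer one, which is bounded by that loop alone, i.e. the loop is the boundary of a
disk whose interior does not meet `D`. (The region is bounded by the loop alone because the regions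
of all darts of `D'` lie in the range of `j`.) -/
def IsLoopRemoval (D D' : LinkDiagram) : Prop :=
  ∃ (i : D'.Dart → D.Dart) (j : D'.Region → D.Region),
    Function.Injective i ∧ Function.Injective j ∧
    (∀ d, i (D'.rot d) = D.rot (i d)) ∧
    (∀ d, i (D'.opp d) = D.opp (i d)) ∧
    (∀ d, D'.AtCrossing d → (d ∈ D'.overDarts ↔ i d ∈ D.overDarts)) ∧
    (∀ d, j (D'.region d) = D.region (i d)) ∧
    j D'.outer = D.outer ∧
    (∃ K : D.Component, ∀ d, d ∉ Set.range i ↔ (Quot.mk _ d : D.Component) = K) ∧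
    (∀ d, d ∉ Set.range i → ¬ D.AtCrossing d) ∧
    (∃! r, r ∉ Set.range j)

/-- The defining rules of the positive Kauffman bracket polynomial `T ↦ [T] ∈ ℤ[A, A⁻¹]`, where
`A = LaurentPolynomial.T 1`: a loop bounding an empty disk contributes the factor `A² + A⁻²`, and
`[crossing] = A [A-smoothing] + A⁻¹ [B-smoothing]`. The `A`-smoothing joins the two corners swept
out by turning the over-strand counterclockwise, the `B`-smoothing joins the two others. The
bracket is the coefficient of the empty diagram, so the empty diagram has bracket `1`. -/
structure IsPositiveBracket (P : LinkDiagram → LaurentPolynomial ℤ) : Prop where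
  empty : ∀ D, IsEmpty D.Dart → P D = 1
  loop : ∀ D D', IsLoopRemoval D D' →
    P D = (LaurentPolynomial.T 2 + LaurentPolynomial.T (-2)) * P D'
  crossing : ∀ (D DA DB : LinkDiagram) (e : D.Dart), e ∈ D.overDarts →
    IsSmoothing D DA e → IsSmoothing D DB (D.rot e) →
    P D = LaurentPolynomial.T 1 * P DA + LaurentPolynomial.T (-1) * P DB

end LinkDiagram

open Classical in
/-- The highest exponent minus the lowest exponent of a nonzero Laurent polynomial (`0` for the zero
polynomial). -/
noncomputable def LaurentPolynomial.totalSpan (f : LaurentPolynomial ℤ) : ℤ :=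
  if h : f.coeff.support.Nonempty then f.coeff.support.max' h - f.coeff.support.min' h else 0

/-! The bracket is the state sum $\sum_s A^{a(s)-b(s)}(A^2+A^{-2})^{|s|}$, where a state $s$ chooses
a smoothing at every crossing, $a(s)$ and $b(s)$ count the $A$- and $B$-smoothings, and $|s|$ counts
loops. A state is encoded as an involution of the half-edges, so loops are classes under this
involution and `opp`. Splitting the states by their choice at one crossing gives rule (iii). On a
crossingless loop the state is forced, which gives rule (ii).

The rules determine the bracket by induction: some crossing can be smoothed, or, if there is none,
some loop bounds an empty disk and can be deleted. Planarity matters here. For a smoothing,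
`euler_inequality` gives one half of Euler's formula, and counting vertices, components and regions
gives the other. For a deletion, counting the sides of loops finds a leaf of the tree of regions and
loops.

The state sum is nonzero because its value at $A=1$ is a sum of powers of 2. For the span, let $s_A$
and $s_B$ be the all-$A$ and all-$B$ states. Changing one smoothing changes the number of loops by
at most one, so $|s|\le|s_A|+b(s)$ and $|s|\le|s_B|+a(s)$. Hence all exponents lie between
$-n-2|s_B|$ and $n+2|s_A|$, and the claim reduces to the dual state lemma $|s_A|+|s_B|\le n+2c$
(`numLoops_add_numLoops_le`).

That lemma is linear algebra over $\mathbb{F}_2$ and needs no planarity. A function on the loops of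
a state yields a function on crossings: the difference of its values on the two arcs there. The
kernel consists of functions constant on components, so it has dimension at most $c$. The images for
two dual states are orthogonal in $\mathbb{F}_2^n$, so their dimensions add up to at most $n$. -/

section QuotCard

/-! ### Counting classes of generated equivalence relations -/

variable {α : Type*} [Finite α]

/-- A coarser relation has fewer classes. -/
theorem card_quot_le_of_eqvGen {r s : α → α → Prop}
    (h : ∀ a b, r a b → Relation.EqvGen s a b) : Nat.card (Quot s) ≤ Nat.card (Quot r) := by
  refine Nat.card_le_card_of_surjective
    (Quot.lift (fun a => Quot.mk s a) fun a b hab => Quot.eqvGen_sound (h a b hab)) ?_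
  rintro ⟨x⟩
  exact ⟨Quot.mk r x, rfl⟩

/-- Identifying one more pair of elements removes at most one class. -/
theorem card_quot_le_card_quot_or_pair (r : α → α → Prop) (a b : α) :
    Nat.card (Quot r) ≤ Nat.card (Quot fun x y => r x y ∨ (x = a ∧ y = b)) + 1 := by
  classical
  set s : α → α → Prop := fun x y => r x y ∨ (x = a ∧ y = b)
  -- The class of `b` is redirected to that of `a`, so `g` inverts `q` away from one class. That
  -- class becomes the `none` of the `Option` below.
  let g : Quot s → Quot r := Quot.lift
    (fun x => if Quot.mk r x = Quot.mk r b then Quot.mk r a else Quot.mk r x) (by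
      rintro x y (h | ⟨rfl, rfl⟩)
      · simp only [Quot.sound h]
      · simp)
  let q : Quot r → Quot s := Quot.lift (fun x => Quot.mk s x) fun x y h => Quot.sound (Or.inl h)
  have hg : ∀ x, x ≠ Quot.mk r b → g (q x) = x := by
    rintro ⟨x⟩ hx
    exact if_neg hx
  rw [← Finite.card_option]
  refine Nat.card_le_card_of_injective
    (fun x => if x = Quot.mk r b then none else some (q x)) ?_
  intro x y hxy
  by_cases hx : x = Quot.mk r b <;> by_cases hy : y = Quot.mk r b <;> simp [hx, hy] at hxy ⊢
  rw [← hg x hx, ← hg y hy, hxy]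

/-- Identifying two inequivalent elements removes a class. -/
theorem card_quot_or_pair_lt (r : α → α → Prop) {a b : α} (hab : ¬ Relation.EqvGen r a b) :
    Nat.card (Quot fun x y => r x y ∨ (x = a ∧ y = b)) + 1 ≤ Nat.card (Quot r) := by
  classical
  have := Fintype.ofFinite (Quot r)
  have := Fintype.ofFinite (Quot fun x y => r x y ∨ (x = a ∧ y = b))
  rw [Nat.card_eq_fintype_card, Nat.card_eq_fintype_card]
  refine Fintype.card_lt_of_surjective_not_injective
    (Quot.lift (fun x => Quot.mk _ x) fun x y h => Quot.sound (Or.inl h)) ?_ ?_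
  · rintro ⟨x⟩
    exact ⟨Quot.mk r x, rfl⟩
  · intro hinj
    refine hab (Quot.eqvGen_exact (hinj ?_))
    exact Quot.sound (Or.inr ⟨rfl, rfl⟩)

/-- Identifying the pairs of a finite set removes at most as many classes. -/
theorem card_quot_le_card_quot_or_mem (r : α → α → Prop) (S : Finset (α × α)) :
    Nat.card (Quot r) ≤ Nat.card (Quot fun x y => r x y ∨ (x, y) ∈ S) + S.card := by
  classical
  induction S using Finset.induction_on with
  | empty => simp
  | insert p S hp ih =>
    have h := card_quot_le_card_quot_or_pair (fun x y => r x y ∨ (x, y) ∈ S) p.1 p.2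
    have e : (fun x y => (r x y ∨ (x, y) ∈ S) ∨ (x = p.1 ∧ y = p.2)) =
        fun x y => r x y ∨ (x, y) ∈ insert p S := by
      funext x y
      rw [Finset.mem_insert, Prod.ext_iff, eq_iff_iff]
      tauto
    rw [e] at h
    rw [Finset.card_insert_of_notMem hp]
    omega

end QuotCard

/-! ### Involutions, and Euler's inequality on surfaces -/

/-- The orbits of a fixed-point-free involution have two elements. -/
theorem two_mul_card_quot_involution {α : Type*} (σ : α → α) (hσ : ∀ a, σ (σ a) = a) (hne : ∀ a, σ a ≠ a) :
    2 * Nat.card (Quot fun a b => b = σ a) = Nat.card α := by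
  classical
  set r : α → α → Prop := fun a b => b = σ a
  have hr : ∀ a b, Relation.EqvGen r a b → b = a ∨ b = σ a := by
    intro a b h
    induction h with
    | rel x y h => exact Or.inr h
    | refl x => exact Or.inl rfl
    | symm x y _ ih => rcases ih with rfl | rfl <;> simp [hσ]
    | trans x y z _ _ ih1 ih2 => rcases ih1 with rfl | rfl <;> rcases ih2 with rfl | rfl <;> simp [hσ]
  have hout : ∀ a, (Quot.mk r a).out = a ∨ (Quot.mk r a).out = σ a := fun a =>
    hr _ _ (Quot.eqvGen_exact (Quot.out_eq (Quot.mk r a)).symm)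
  have hσr : ∀ a, Quot.mk r (σ a) = Quot.mk r a := fun a =>
    (Quot.sound (show r a (σ a) from rfl)).symm
  have : Nat.card (Quot r × Bool) = Nat.card α := by
    refine Nat.card_congr ⟨fun p => if p.2 then p.1.out else σ p.1.out,
      fun a => (Quot.mk r a, (Quot.mk r a).out = a), ?_, ?_⟩
    · rintro ⟨x, b⟩
      cases b
      · simp [hσr, (hne _).symm]
      · simp
    · intro a
      rcases hout a with h | h
      · simp [h]
      · simp [h, hne, hσ]
  rw [← this, Nat.card_prod]
  simp [mul_comm]

/-- A fixed-point-free involution of a finite set has a transversal. -/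
theorem Finset.exists_transversal_of_involution {α : Type*} [DecidableEq α] (σ : α → α)
    (hσ : ∀ a, σ (σ a) = a) (X : Finset α) (hX : ∀ a ∈ X, σ a ∈ X) (hne : ∀ a ∈ X, σ a ≠ a) :
    ∃ S ⊆ X, 2 * S.card = X.card ∧ ∀ a ∈ X, a ∈ S ∨ σ a ∈ S := by
  induction X using Finset.strongInduction with
  | H X ih =>
    rcases X.eq_empty_or_nonempty with rfl | ⟨x, hx⟩
    · exact ⟨∅, by simp⟩
    · have hinj : ∀ a b, σ a = b ↔ a = σ b := fun a b => by
        constructor <;> (rintro rfl; simp [hσ])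
      obtain ⟨S, hS, hc, hcov⟩ := ih ((X.erase x).erase (σ x))
        ((Finset.erase_subset _ _).trans_ssubset (Finset.erase_ssubset hx))
        (fun a ha => by
          simp only [Finset.mem_erase] at ha ⊢
          refine ⟨fun h => ha.2.1 ?_, fun h => ha.1 ((hinj _ _).1 h), hX a ha.2.2⟩
          rw [← hσ a, h, hσ])
        (fun a ha => hne a (by simp only [Finset.mem_erase] at ha; exact ha.2.2))
      have hxS : x ∉ S := fun h => by simpa using hS h
      refine ⟨insert x S, Finset.insert_subset hx
        (hS.trans ((Finset.erase_subset _ _).trans (Finset.erase_subset _ _))), ?_, ?_⟩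
      · rw [Finset.card_insert_of_notMem hxS, Nat.mul_add, hc, Finset.card_erase_of_mem
          (Finset.mem_erase.2 ⟨hne x hx, hX x hx⟩), Finset.card_erase_of_mem hx]
        have : 2 ≤ X.card := by
          rw [← Finset.card_pair (hne x hx)]
          exact Finset.card_le_card (Finset.insert_subset (hX x hx) (by simpa using hx))
        omega
      · intro a ha
        by_cases h1 : a = x
        · simp [h1]
        by_cases h2 : a = σ x
        · simp [h2, hσ]
        · rcases hcov a (by simp [h1, h2, ha]) with h | h <;> simp [h]

/-- Euler's inequality: for a graph embedded in a surface, with regions that are connected to each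
other across the edges, `V - E + R ≤ 1 + C`. The coboundaries of functions on vertices and on
regions are orthogonal in the space of antisymmetric functions on darts. -/
theorem euler_inequality {α R : Type*} [Finite α] [Finite R] (rot opp : Equiv.Perm α)
    (opp_opp : ∀ d, opp (opp d) = d) (outer : R) (region : α → R)
    (region_face : ∀ d, region (opp (rot d)) = region d)
    (connected : ∀ r s,
      Relation.ReflTransGen (fun r s => ∃ d, region d = r ∧ region (opp d) = s) r s) :
    Nat.card (Quot fun a b => b = rot a) + Nat.card R ≤
      Nat.card (Quot fun a b => b = opp a) +
        Nat.card (Quot fun a b => b = rot a ∨ b = opp a) + 1 := by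
  classical
  have := Fintype.ofFinite α
  have := Fintype.ofFinite R
  set rV : α → α → Prop := fun a b => b = rot a
  set rE : α → α → Prop := fun a b => b = opp a
  set rC : α → α → Prop := fun a b => b = rot a ∨ b = opp a
  have := Fintype.ofFinite (Quot rV)
  have := Fintype.ofFinite (Quot rE)
  have := Fintype.ofFinite (Quot rC)
  let f : (Quot rV → ℚ) →ₗ[ℚ] (α → ℚ) :=
    LinearMap.funLeft ℚ ℚ (fun d => Quot.mk rV (opp d)) - LinearMap.funLeft ℚ ℚ (Quot.mk rV)
  let g : (R → ℚ) →ₗ[ℚ] (α → ℚ) :=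
    LinearMap.funLeft ℚ ℚ (fun d => region (opp d)) - LinearMap.funLeft ℚ ℚ region
  have hf : ∀ h d, f h d = h (Quot.mk rV (opp d)) - h (Quot.mk rV d) := fun h d => rfl
  have hg : ∀ h d, g h d = h (region (opp d)) - h (region d) := fun h d => rfl
  let anti : Submodule ℚ (α → ℚ) :=
    { carrier := {x | ∀ d, x (opp d) = - x d}
      add_mem' := fun {x y} hx hy d => by simp [hx d, hy d]; ring
      zero_mem' := fun d => by simp
      smul_mem' := fun c x hx d => by simp [hx d] }
  -- An antisymmetric function is determined by its values on one chosen dart per edge.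
  have hanti : Module.finrank ℚ anti ≤ Fintype.card (Quot rE) := by
    rw [← Module.finrank_fintype_fun_eq_card ℚ]
    refine LinearMap.finrank_le_finrank_of_injective
      (f := (LinearMap.funLeft ℚ ℚ (fun x : Quot rE => x.out)).comp anti.subtype) ?_
    rw [← LinearMap.ker_eq_bot, LinearMap.ker_eq_bot']
    intro x hx
    have key : ∀ a b, Relation.EqvGen rE a b → (x.1 a = 0 ↔ x.1 b = 0) := by
      intro a b h
      induction h with
      | rel a b h => rw [show b = opp a from h, x.2 a, neg_eq_zero]
      | refl => rfl
      | symm _ _ _ ih => exact ih.symm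
      | trans _ _ _ _ _ ih1 ih2 => exact ih1.trans ih2
    ext d
    exact (key _ _ (Quot.eqvGen_exact (Quot.out_eq (Quot.mk rE d)))).1 (congrFun hx (Quot.mk rE d))
  have hfker : Module.finrank ℚ (LinearMap.ker f) ≤ Fintype.card (Quot rC) := by
    let p : Quot rV → Quot rC := Quot.lift (Quot.mk rC) fun a b h => Quot.sound (Or.inl h)
    calc Module.finrank ℚ (LinearMap.ker f)
        ≤ Module.finrank ℚ (LinearMap.range (LinearMap.funLeft ℚ ℚ p)) := by
          refine Submodule.finrank_mono fun h hh => ?_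
          refine ⟨Quot.lift (fun d => h (Quot.mk rV d)) ?_, ?_⟩
          · rintro a b (rfl | rfl)
            · exact congrArg h (Quot.sound rfl)
            · have := congrFun (LinearMap.mem_ker.1 hh) a
              rw [hf, Pi.zero_apply, sub_eq_zero] at this
              exact this.symm
          · funext x
            obtain ⟨d, rfl⟩ := Quot.exists_rep x
            rfl
      _ ≤ Module.finrank ℚ (Quot rC → ℚ) := LinearMap.finrank_range_le _
      _ = _ := Module.finrank_fintype_fun_eq_card ℚ
  have hgker : Module.finrank ℚ (LinearMap.ker g) ≤ 1 := by
    calc Module.finrank ℚ (LinearMap.ker g)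
        ≤ Module.finrank ℚ (Submodule.span ℚ {(fun _ => 1 : R → ℚ)}) := by
          refine Submodule.finrank_mono fun h hh => ?_
          rw [Submodule.mem_span_singleton]
          refine ⟨h outer, funext fun s => ?_⟩
          suffices h outer = h s by simpa using this
          have := connected outer s
          induction this with
          | refl => rfl
          | tail _ hst ih =>
            obtain ⟨d, rfl, rfl⟩ := hst
            have := congrFun (LinearMap.mem_ker.1 hh) d
            rw [hg, Pi.zero_apply, sub_eq_zero] at this
            rw [ih, this]
      _ ≤ 1 := (finrank_span_le_card _).trans (by simp)
  -- The product expands into four sums, all equal: reindexing by `opp` gives `h1` and `h2`, and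
  -- turning around a vertex with `region_face` gives `h3`.
  have horth : ∀ h k, ∑ d, f h d * g k d = 0 := by
    intro h k
    have h1 : ∑ d, h (Quot.mk rV (opp d)) * k (region (opp d)) =
        ∑ d, h (Quot.mk rV d) * k (region d) :=
      Equiv.sum_comp opp (fun d => h (Quot.mk rV d) * k (region d))
    have h2 : ∑ d, h (Quot.mk rV (opp d)) * k (region d) =
        ∑ d, h (Quot.mk rV d) * k (region (opp d)) := by
      rw [← Equiv.sum_comp opp]
      simp [opp_opp]
    have h3 : ∑ d, h (Quot.mk rV d) * k (region (opp d)) =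
        ∑ d, h (Quot.mk rV d) * k (region d) := by
      rw [← Equiv.sum_comp rot]
      refine Finset.sum_congr rfl fun d _ => ?_
      rw [region_face, ← Quot.sound (show rV d (rot d) from rfl)]
    simp only [hf, hg, sub_mul, mul_sub, Finset.sum_sub_distrib]
    rw [h1, h2, h3]
    ring
  -- Over ℚ a vector orthogonal to itself vanishes, so the ranks of `f` and `g` add up inside
  -- `anti`.
  have hinf : LinearMap.range f ⊓ LinearMap.range g = ⊥ := by
    rw [eq_bot_iff]
    rintro x ⟨⟨h, rfl⟩, ⟨k, hk⟩⟩
    have := horth h k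
    rw [hk, Finset.sum_eq_zero_iff_of_nonneg fun d _ => mul_self_nonneg _] at this
    rw [Submodule.mem_bot]
    funext d
    exact mul_self_eq_zero.1 (this d (Finset.mem_univ d))
  have hsup : LinearMap.range f ⊔ LinearMap.range g ≤ anti := by
    refine sup_le ?_ ?_
    · rintro _ ⟨h, rfl⟩ d
      simp [hf, opp_opp]
    · rintro _ ⟨h, rfl⟩ d
      simp [hg, opp_opp]
  have h1 := Submodule.finrank_sup_add_finrank_inf_eq (LinearMap.range f) (LinearMap.range g)
  rw [hinf, finrank_bot] at h1
  have h2 := Submodule.finrank_mono hsup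
  have h3 := LinearMap.finrank_range_add_finrank_ker f
  have h4 := LinearMap.finrank_range_add_finrank_ker g
  rw [Module.finrank_fintype_fun_eq_card] at h3 h4
  simp only [Nat.card_eq_fintype_card]
  omega

/-- A subset closed under the relation, whose complement is a single class. -/
theorem card_quot_eq_card_quot_add_one {α β : Type*} [Finite α] {i : β → α}
    (hi : Function.Injective i) {r : α → α → Prop} {r' : β → β → Prop}
    (h1 : ∀ x y, r (i x) (i y) ↔ r' x y)
    (h2 : ∀ x y, r x y → (x ∈ Set.range i ↔ y ∈ Set.range i)) {k : α} (hk : k ∉ Set.range i)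
    (hkr : ∀ x, x ∉ Set.range i → Relation.EqvGen r k x) :
    Nat.card (Quot r) = Nat.card (Quot r') + 1 := by
  classical
  have := Finite.of_injective i hi
  rw [← Finite.card_option]
  symm
  let F : Option (Quot r') → Quot r := fun o => o.elim (Quot.mk r k)
    (Quot.lift (fun x => Quot.mk r (i x)) fun x y h => Quot.sound ((h1 x y).2 h))
  let G : Quot r → Option (Quot r') := Quot.lift
    (fun x => if h : x ∈ Set.range i then some (Quot.mk r' h.choose) else none) (by
      intro x y hxy
      by_cases hx : x ∈ Set.range i
      · have hy := (h2 x y hxy).1 hx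
        simp only [hx, hy, dite_true]
        congr 1
        refine Quot.sound ((h1 _ _).1 ?_)
        rwa [hx.choose_spec, hy.choose_spec]
      · have hy := fun h => hx ((h2 x y hxy).2 h)
        rw [dif_neg hx, dif_neg hy])
  refine Nat.card_congr ⟨F, G, ?_, ?_⟩
  · rintro (_ | ⟨⟨x⟩⟩)
    · exact dif_neg hk
    · have hx : i x ∈ Set.range i := ⟨x, rfl⟩
      exact (dif_pos hx).trans <| congrArg (fun y => some (Quot.mk r' y)) (hi hx.choose_spec)
  · rintro ⟨x⟩
    by_cases hx : x ∈ Set.range i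
    · have : G (Quot.mk r x) = some (Quot.mk r' hx.choose) := dif_pos hx
      rw [this]
      change Quot.mk r (i hx.choose) = Quot.mk r x
      rw [hx.choose_spec]
    · have : G (Quot.mk r x) = none := dif_neg hx
      rw [this]
      exact Quot.eqvGen_sound (hkr x hx)

/-! ### States and the state sum -/

namespace LinkDiagram

open Classical LaurentPolynomial

instance (D : LinkDiagram) : Finite D.Dart := D.finite_dart
instance (D : LinkDiagram) : Finite D.Region := D.finite_region
noncomputable instance (D : LinkDiagram) : Fintype D.Dart := Fintype.ofFinite _
noncomputable instance (D : LinkDiagram) : Fintype D.Region := Fintype.ofFinite _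
instance (D : LinkDiagram) : Finite D.Vertex := inferInstanceAs (Finite (Quot _))
instance (D : LinkDiagram) : Finite D.Component := inferInstanceAs (Finite (Quot _))

variable (D : LinkDiagram)

/-- `d` is a half-edge at the vertex of `e`. -/
def OfVertex (e d : D.Dart) : Prop :=
  d = e ∨ d = D.rot e ∨ d = D.rot (D.rot e) ∨ d = D.rot (D.rot (D.rot e))

theorem ofVertex_rot {e d : D.Dart} : D.OfVertex e (D.rot d) ↔ D.OfVertex e d := by
  have h := D.rot_four
  have hi := D.rot.injective
  constructor
  · rintro (h1 | h1 | h1 | h1)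
    · exact Or.inr (Or.inr (Or.inr (hi (by rw [h1, h]))))
    · exact Or.inl (hi h1)
    · exact Or.inr (Or.inl (hi h1))
    · exact Or.inr (Or.inr (Or.inl (hi h1)))
  · rintro (rfl | rfl | rfl | rfl) <;> simp [OfVertex, h]

theorem atCrossing_rot {d : D.Dart} : D.AtCrossing (D.rot d) ↔ D.AtCrossing d := by
  simp [AtCrossing]

theorem rot_eq_iff {a b : D.Dart} : D.rot a = b ↔ a = D.rot (D.rot (D.rot b)) := by
  constructor
  · rintro rfl; rw [D.rot_four]
  · rintro rfl; rw [D.rot_four]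

theorem vertex_mk_eq_iff {e d : D.Dart} :
    (Quot.mk _ e : D.Vertex) = Quot.mk _ d ↔ D.OfVertex e d := by
  constructor
  · intro h
    have key : ∀ a b, Relation.EqvGen (fun a b => b = D.rot a) a b →
        (D.OfVertex e a ↔ D.OfVertex e b) := by
      intro a b h
      induction h with
      | rel a b h => rw [h, ofVertex_rot]
      | refl => rfl
      | symm _ _ _ ih => exact ih.symm
      | trans _ _ _ _ _ ih1 ih2 => exact ih1.trans ih2
    exact (key _ _ (Quot.eqvGen_exact h)).1 (Or.inl rfl)
  · have h : ∀ a : D.Dart, (Quot.mk _ (D.rot a) : D.Vertex) = Quot.mk _ a := fun a =>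
      (Quot.sound (r := fun a b => b = D.rot a) rfl).symm
    rintro (rfl | rfl | rfl | rfl) <;> simp only [h]

theorem overDarts_rot_rot {d : D.Dart} (hd : D.AtCrossing d) :
    D.rot (D.rot d) ∈ D.overDarts ↔ d ∈ D.overDarts := by
  rw [D.overDarts_rot _ (D.atCrossing_rot.2 hd), D.overDarts_rot _ hd, not_not]

/-- A state: a choice of smoothing at every crossing, given by the involution that joins the
half-edges at each vertex. -/
def IsState (τ : Equiv.Perm D.Dart) : Prop :=
  ∀ d, τ (τ d) = d ∧ (τ d = D.rot d ∨ D.rot (τ d) = d)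

/-- The number of loops of a state. -/
noncomputable def numLoops (τ : Equiv.Perm D.Dart) : ℕ :=
  Nat.card (Quot fun a b => b = τ a ∨ b = D.opp a)

/-- The over-darts at the `A`-smoothed crossings. -/
def aDarts (τ : Equiv.Perm D.Dart) : Set D.Dart :=
  {d | D.AtCrossing d ∧ d ∈ D.overDarts ∧ D.rot (τ d) = d}

/-- The over-darts at the `B`-smoothed crossings. -/
def bDarts (τ : Equiv.Perm D.Dart) : Set D.Dart :=
  {d | D.AtCrossing d ∧ d ∈ D.overDarts ∧ τ d = D.rot d}

/-- The number of `A`-smoothed crossings. -/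
noncomputable def numA (τ : Equiv.Perm D.Dart) : ℕ := (D.aDarts τ).ncard / 2

/-- The number of `B`-smoothed crossings. -/
noncomputable def numB (τ : Equiv.Perm D.Dart) : ℕ := (D.bDarts τ).ncard / 2

/-- The contribution of a state to the bracket. -/
noncomputable def weight (τ : Equiv.Perm D.Dart) : ℤ[T;T⁻¹] :=
  T ((D.numA τ : ℤ) - D.numB τ) * (T 2 + T (-2)) ^ D.numLoops τ

/-- The states of a diagram. -/
noncomputable def states : Finset (Equiv.Perm D.Dart) := Finset.univ.filter D.IsState

/-- The state sum of the positive Kauffman bracket. -/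
noncomputable def stateSum : ℤ[T;T⁻¹] := ∑ τ ∈ D.states, D.weight τ

variable {D}

theorem mem_states {τ : Equiv.Perm D.Dart} : τ ∈ D.states ↔ D.IsState τ := by simp [states]

theorem IsState.eq_rot {τ : Equiv.Perm D.Dart} (h : D.IsState τ) {d : D.Dart}
    (hd : ¬ D.AtCrossing d) : τ d = D.rot d := by
  rcases (h d).2 with h1 | h1
  · exact h1
  · apply D.rot.injective
    rw [h1, not_not.1 hd]

theorem IsState.not_both {τ : Equiv.Perm D.Dart} {d : D.Dart} (hd : D.AtCrossing d)
    (h1 : τ d = D.rot d) : D.rot (τ d) ≠ d := by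
  rw [h1]; exact hd

/-- A state that joins `e` to `rot³ e` joins `rot e` to `rot² e`. -/
theorem IsState.eq_rot_rot {τ : Equiv.Perm D.Dart} (h : D.IsState τ) {e : D.Dart}
    (he : D.AtCrossing e) (h1 : D.rot (τ e) = e) : τ (D.rot e) = D.rot (D.rot e) := by
  rcases (h (D.rot e)).2 with h2 | h2
  · exact h2
  · have h3 : τ (D.rot e) = e := D.rot.injective h2
    have h4 := (h (D.rot e)).1
    rw [h3] at h4
    exact absurd h1 (IsState.not_both he h4)

/-- A state that joins `e` to `rot e` joins `rot² e` to `rot³ e`. -/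
theorem IsState.rot_eq_rot_rot {τ : Equiv.Perm D.Dart} (h : D.IsState τ) {e : D.Dart}
    (he : D.AtCrossing e) (h1 : τ e = D.rot e) :
    τ (D.rot (D.rot e)) = D.rot (D.rot (D.rot e)) := by
  refine h.eq_rot_rot (D.atCrossing_rot.2 he) ?_
  rw [← h1, (h e).1, h1]

theorem IsState.apply_eq {τ : Equiv.Perm D.Dart} (h : D.IsState τ) {e : D.Dart}
    (he : D.AtCrossing e) (h1 : D.rot (τ e) = e) :
    τ e = D.rot (D.rot (D.rot e)) ∧ τ (D.rot e) = D.rot (D.rot e) ∧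
      τ (D.rot (D.rot e)) = D.rot e ∧ τ (D.rot (D.rot (D.rot e))) = e := by
  have h2 := D.rot_eq_iff.1 h1
  have h3 := h.eq_rot_rot he h1
  refine ⟨h2, h3, ?_, ?_⟩
  · rw [← h3, (h _).1]
  · rw [← h2, (h _).1]

/-- The half-edges at a crossing are distinct. -/
theorem AtCrossing.distinct {e : D.Dart} (he : D.AtCrossing e) :
    e ≠ D.rot e ∧ e ≠ D.rot (D.rot e) ∧ e ≠ D.rot (D.rot (D.rot e)) ∧
      D.rot e ≠ D.rot (D.rot e) ∧ D.rot e ≠ D.rot (D.rot (D.rot e)) ∧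
      D.rot (D.rot e) ≠ D.rot (D.rot (D.rot e)) := by
  have h := D.rot_ne
  refine ⟨(h _).symm, he.symm, fun h1 => ?_, (h _).symm, fun h1 => ?_, (h _).symm⟩
  · exact h e (D.rot_eq_iff.2 h1)
  · exact he (D.rot.injective h1).symm

/-! ### The state sum under smoothing a crossing -/

section Smoothing

variable {D' : LinkDiagram} {e : D.Dart} {f : D.Dart ≃ D'.Dart}

/-- The part of a smoothing that concerns the rotation. -/
structure RotSmoothing (D D' : LinkDiagram) (e : D.Dart) (f : D.Dart ≃ D'.Dart) : Prop where
  atCrossing : D.AtCrossing e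
  opp : ∀ d, D'.opp (f d) = f (D.opp d)
  rot0 : D'.rot (f e) = f (D.rot (D.rot (D.rot e)))
  rot3 : D'.rot (f (D.rot (D.rot (D.rot e)))) = f e
  rot1 : D'.rot (f (D.rot e)) = f (D.rot (D.rot e))
  rot2 : D'.rot (f (D.rot (D.rot e))) = f (D.rot e)
  rot : ∀ d, ¬ D.OfVertex e d → D'.rot (f d) = f (D.rot d)
  overDarts : ∀ d, ¬ D.OfVertex e d → D.AtCrossing d → (f d ∈ D'.overDarts ↔ d ∈ D.overDarts)

theorem IsSmoothing.exists_rotSmoothing (h : IsSmoothing D D' e) :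
    ∃ f, RotSmoothing D D' e f := by
  obtain ⟨he, f, q, h1, h2, h3, h4, h5, h6, -⟩ := h
  refine ⟨f, he, h1, h2, h3, h4, h5, fun d hd => ?_, fun d hd => ?_⟩ <;>
  · simp only [OfVertex, not_or] at hd
    first
      | exact (h6 d hd.1 hd.2.1 hd.2.2.1 hd.2.2.2).1
      | exact (h6 d hd.1 hd.2.1 hd.2.2.1 hd.2.2.2).2

theorem RotSmoothing.ofVertex_iff (h : RotSmoothing D D' e f) {x y : D.Dart}
    (hxy : D'.rot (f x) = f y) : D.OfVertex e x ↔ D.OfVertex e y := by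
  by_cases hx : D.OfVertex e x
  · refine iff_of_true hx ?_
    rcases hx with rfl | rfl | rfl | rfl
    · rw [h.rot0] at hxy; rw [← f.injective hxy]; simp [OfVertex]
    · rw [h.rot1] at hxy; rw [← f.injective hxy]; simp [OfVertex]
    · rw [h.rot2] at hxy; rw [← f.injective hxy]; simp [OfVertex]
    · rw [h.rot3] at hxy; rw [← f.injective hxy]; simp [OfVertex]
  · rw [h.rot x hx] at hxy
    rw [← f.injective hxy, ofVertex_rot]

theorem RotSmoothing.atCrossing_iff (h : RotSmoothing D D' e f) (d : D.Dart) :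
    D'.AtCrossing (f d) ↔ D.AtCrossing d ∧ ¬ D.OfVertex e d := by
  by_cases hd : D.OfVertex e d
  · refine iff_of_false ?_ fun h => h.2 hd
    unfold AtCrossing
    rw [not_not]
    rcases hd with rfl | rfl | rfl | rfl
    · rw [h.rot0, h.rot3]
    · rw [h.rot1, h.rot2]
    · rw [h.rot2, h.rot1]
    · rw [h.rot3, h.rot0]
  · unfold AtCrossing
    rw [h.rot d hd, h.rot _ (by rwa [ofVertex_rot]), f.injective.ne_iff]
    exact (and_iff_left hd).symm

/-- The smoothed crossing becomes two bivalent vertices, where a state has no choice. States of the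
smoothed diagram are therefore the states of `D` that already make this choice at `e`. -/
theorem RotSmoothing.isState_iff (h : RotSmoothing D D' e f) (τ : Equiv.Perm D.Dart) :
    D'.IsState (f.permCongr τ) ↔ D.IsState τ ∧ D.rot (τ e) = e := by
  have happ : ∀ d, (f.permCongr τ) (f d) = f (τ d) := fun d => by simp
  have hst : D'.IsState (f.permCongr τ) ↔
      ∀ d, τ (τ d) = d ∧ (D'.rot (f d) = f (τ d) ∨ D'.rot (f (τ d)) = f d) := by
    unfold IsState
    rw [f.surjective.forall]
    refine forall_congr' fun d => ?_
    rw [happ, happ, f.injective.eq_iff, eq_comm (a := f (τ d))]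
  rw [hst]
  constructor
  · intro hs
    -- At a bivalent vertex both alternatives in `IsState` coincide.
    have key : ∀ a b : D.Dart, D'.rot (f a) = f b → D'.rot (f b) = f a → τ a = b := by
      intro a b hab hba
      rcases (hs a).2 with h1 | h1
      · exact f.injective (h1.symm.trans hab)
      · exact f.injective (D'.rot.injective (h1.trans hba.symm))
    have k0 := key _ _ h.rot0 h.rot3
    have k1 := key _ _ h.rot1 h.rot2
    have k2 := key _ _ h.rot2 h.rot1
    have k3 := key _ _ h.rot3 h.rot0
    refine ⟨fun d => ⟨(hs d).1, ?_⟩, ?_⟩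
    · by_cases hd : D.OfVertex e d
      · rcases hd with rfl | rfl | rfl | rfl
        · rw [k0, D.rot_four]; exact Or.inr rfl
        · exact Or.inl k1
        · rw [k2]; exact Or.inr rfl
        · rw [k3, D.rot_four]; exact Or.inl rfl
      · rcases (hs d).2 with h1 | h1
        · rw [h.rot d hd] at h1
          exact Or.inl (f.injective h1).symm
        · rw [h.rot _ fun h2 => hd ((h.ofVertex_iff h1).1 h2)] at h1
          exact Or.inr (f.injective h1)
    · rw [k0, D.rot_four]
  · rintro ⟨hs, h1⟩ d
    refine ⟨(hs d).1, ?_⟩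
    obtain ⟨k0, k1, k2, k3⟩ := hs.apply_eq h.atCrossing h1
    by_cases hd : D.OfVertex e d
    · left
      rcases hd with rfl | rfl | rfl | rfl
      · rw [k0, h.rot0]
      · rw [k1, h.rot1]
      · rw [k2, h.rot2]
      · rw [k3, h.rot3]
    · rcases (hs d).2 with h2 | h2
      · left
        rw [h.rot d hd, h2]
      · right
        rw [h.rot _ fun h3 => hd (by rwa [← D.ofVertex_rot, h2] at h3), h2]

theorem RotSmoothing.numLoops_eq (h : RotSmoothing D D' e f) (τ : Equiv.Perm D.Dart) :
    D'.numLoops (f.permCongr τ) = D.numLoops τ := by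
  refine (Nat.card_congr (Quot.congr f fun a b => ?_)).symm
  rw [h.opp, Equiv.permCongr_apply, Equiv.symm_apply_apply, f.injective.eq_iff, f.injective.eq_iff]

theorem RotSmoothing.aDarts_eq (h : RotSmoothing D D' e f) (τ : Equiv.Perm D.Dart) :
    (D'.aDarts (f.permCongr τ)).ncard =
      {d | d ∈ D.aDarts τ ∧ ¬ D.OfVertex e d}.ncard := by
  rw [← Set.ncard_image_of_injective _ f.injective]
  congr 1
  ext x
  obtain ⟨d, rfl⟩ := f.surjective x
  rw [f.injective.mem_set_image]
  simp only [aDarts, Set.mem_ofPred_eq, h.atCrossing_iff, Equiv.permCongr_apply,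
    Equiv.symm_apply_apply]
  by_cases hd : D.OfVertex e d
  · simp [hd]
  by_cases hc : D.AtCrossing d
  · simp only [hd, hc, h.overDarts d hd hc, not_false_eq_true, true_and, and_true]
    refine and_congr_right fun _ => ⟨fun h1 => ?_, fun h1 => ?_⟩
    · rw [h.rot _ fun h2 => hd ((h.ofVertex_iff h1).1 h2)] at h1
      exact f.injective h1
    · rw [h.rot _ fun h3 => hd (by rwa [← D.ofVertex_rot, h1] at h3), h1]
  · simp [hc]

theorem RotSmoothing.bDarts_eq (h : RotSmoothing D D' e f) (τ : Equiv.Perm D.Dart) :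
    (D'.bDarts (f.permCongr τ)).ncard = {d | d ∈ D.bDarts τ ∧ ¬ D.OfVertex e d}.ncard := by
  rw [← Set.ncard_image_of_injective _ f.injective]
  congr 1
  ext x
  obtain ⟨d, rfl⟩ := f.surjective x
  rw [f.injective.mem_set_image]
  simp only [bDarts, Set.mem_ofPred_eq, h.atCrossing_iff, Equiv.permCongr_apply,
    Equiv.symm_apply_apply]
  by_cases hd : D.OfVertex e d
  · simp [hd]
  by_cases hc : D.AtCrossing d
  · simp only [hd, hc, h.overDarts d hd hc, h.rot d hd, f.injective.eq_iff, not_false_eq_true, true_and,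
      and_true]
  · simp [hc]

theorem ncard_eq_add_two {α : Type*} [Finite α] {s : Set α} {p : α → Prop} {x y : α} (hxy : x ≠ y)
    (h : ∀ d, d ∈ s ∧ p d ↔ d = x ∨ d = y) : s.ncard = {d | d ∈ s ∧ ¬ p d}.ncard + 2 := by
  have h1 : s = {d | d ∈ s ∧ ¬ p d} ∪ {x, y} := by
    ext d
    have := h d
    simp only [Set.mem_union, Set.mem_ofPred_eq, Set.mem_insert_iff, Set.mem_singleton_iff]
    tauto
  conv_lhs => rw [h1]
  rw [Set.ncard_union_eq _ (Set.toFinite _) (Set.toFinite _), Set.ncard_pair hxy]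
  rw [Set.disjoint_left]
  intro d hd hd'
  exact hd.2 ((h d).2 hd').2

theorem aDarts_and_ofVertex_iff {τ : Equiv.Perm D.Dart} (hτ : D.IsState τ) (he : D.AtCrossing e)
    (h1 : D.rot (τ e) = e) (ho : e ∈ D.overDarts) (d : D.Dart) :
    d ∈ D.aDarts τ ∧ D.OfVertex e d ↔ d = e ∨ d = D.rot (D.rot e) := by
  obtain ⟨k0, k1, k2, k3⟩ := hτ.apply_eq he h1
  have o1 : D.rot e ∉ D.overDarts := by rw [D.overDarts_rot e he]; exact not_not.2 ho
  have o2 := (D.overDarts_rot_rot he).2 ho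
  have o3 := mt (D.overDarts_rot_rot (D.atCrossing_rot.2 he)).1 o1
  constructor
  · rintro ⟨⟨-, hd, -⟩, rfl | rfl | rfl | rfl⟩
    · exact Or.inl rfl
    · exact absurd hd o1
    · exact Or.inr rfl
    · exact absurd hd o3
  · rintro (rfl | rfl)
    · exact ⟨⟨he, ho, h1⟩, Or.inl rfl⟩
    · refine ⟨⟨?_, o2, by rw [k2]⟩, by simp [OfVertex]⟩
      simpa only [atCrossing_rot] using he

theorem bDarts_and_ofVertex_iff {τ : Equiv.Perm D.Dart} (hτ : D.IsState τ) (he : D.AtCrossing e)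
    (h1 : D.rot (τ e) = e) (ho : e ∉ D.overDarts) (d : D.Dart) :
    d ∈ D.bDarts τ ∧ D.OfVertex e d ↔ d = D.rot e ∨ d = D.rot (D.rot (D.rot e)) := by
  obtain ⟨k0, k1, k2, k3⟩ := hτ.apply_eq he h1
  have o1 : D.rot e ∈ D.overDarts := (D.overDarts_rot e he).2 ho
  have o2 := mt (D.overDarts_rot_rot he).1 ho
  have o3 := (D.overDarts_rot_rot (D.atCrossing_rot.2 he)).2 o1
  constructor
  · rintro ⟨⟨-, hd, -⟩, rfl | rfl | rfl | rfl⟩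
    · exact absurd hd ho
    · exact Or.inl rfl
    · exact absurd hd o2
    · exact Or.inr rfl
  · rintro (rfl | rfl)
    · exact ⟨⟨D.atCrossing_rot.2 he, o1, k1⟩, by simp [OfVertex]⟩
    · refine ⟨⟨?_, o3, by rw [k3, D.rot_four]⟩, by simp [OfVertex]⟩
      simpa only [atCrossing_rot] using he

theorem aDarts_not_ofVertex {τ : Equiv.Perm D.Dart} (hτ : D.IsState τ) (he : D.AtCrossing e)
    (h1 : D.rot (τ e) = e) (ho : e ∉ D.overDarts) :
    {d | d ∈ D.aDarts τ ∧ ¬ D.OfVertex e d} = D.aDarts τ := by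
  refine Set.Subset.antisymm (fun d hd => hd.1) fun d hd => ⟨hd, fun hv => ?_⟩
  have hb : d ∈ D.bDarts τ := by
    refine ((bDarts_and_ofVertex_iff hτ he h1 ho d).2 ?_).1
    rcases hv with rfl | rfl | rfl | rfl
    · exact absurd hd.2.1 ho
    · exact Or.inl rfl
    · exact absurd hd.2.1 (mt (D.overDarts_rot_rot he).1 ho)
    · exact Or.inr rfl
  exact IsState.not_both hd.1 hb.2.2 hd.2.2

theorem bDarts_not_ofVertex {τ : Equiv.Perm D.Dart} (hτ : D.IsState τ) (he : D.AtCrossing e)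
    (h1 : D.rot (τ e) = e) (ho : e ∈ D.overDarts) :
    {d | d ∈ D.bDarts τ ∧ ¬ D.OfVertex e d} = D.bDarts τ := by
  refine Set.Subset.antisymm (fun d hd => hd.1) fun d hd => ⟨hd, fun hv => ?_⟩
  have ha : d ∈ D.aDarts τ := by
    refine ((aDarts_and_ofVertex_iff hτ he h1 ho d).2 ?_).1
    have o1 : D.rot e ∉ D.overDarts := by rw [D.overDarts_rot e he]; exact not_not.2 ho
    rcases hv with rfl | rfl | rfl | rfl
    · exact Or.inl rfl
    · exact absurd hd.2.1 o1
    · exact Or.inr rfl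
    · exact absurd hd.2.1 (mt (D.overDarts_rot_rot (D.atCrossing_rot.2 he)).1 o1)
  exact IsState.not_both hd.1 hd.2.2 ha.2.2

theorem RotSmoothing.weight_over (h : RotSmoothing D D' e f) {τ : Equiv.Perm D.Dart}
    (hτ : D.IsState τ) (h1 : D.rot (τ e) = e) (ho : e ∈ D.overDarts) :
    D.weight τ = T 1 * D'.weight (f.permCongr τ) := by
  -- The smoothed crossing accounts for exactly two over-darts, so the halved count drops by one
  -- regardless of parity.
  have hA : D.numA τ = D'.numA (f.permCongr τ) + 1 := by
    unfold numA
    rw [h.aDarts_eq τ, ncard_eq_add_two h.atCrossing.symm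
      (aDarts_and_ofVertex_iff hτ h.atCrossing h1 ho)]
    omega
  have hB : D.numB τ = D'.numB (f.permCongr τ) := by
    unfold numB
    rw [h.bDarts_eq τ, bDarts_not_ofVertex hτ h.atCrossing h1 ho]
  rw [weight, weight, hA, hB, h.numLoops_eq, ← mul_assoc, ← T_add]
  congr 2
  push_cast
  ring

theorem RotSmoothing.weight_under (h : RotSmoothing D D' e f) {τ : Equiv.Perm D.Dart}
    (hτ : D.IsState τ) (h1 : D.rot (τ e) = e) (ho : e ∉ D.overDarts) :
    D.weight τ = T (-1) * D'.weight (f.permCongr τ) := by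
  have hB : D.numB τ = D'.numB (f.permCongr τ) + 1 := by
    unfold numB
    rw [h.bDarts_eq τ, ncard_eq_add_two h.atCrossing.distinct.2.2.2.2.1
      (bDarts_and_ofVertex_iff hτ h.atCrossing h1 ho)]
    omega
  have hA : D.numA τ = D'.numA (f.permCongr τ) := by
    unfold numA
    rw [h.aDarts_eq τ, aDarts_not_ofVertex hτ h.atCrossing h1 ho]
  rw [weight, weight, hA, hB, h.numLoops_eq, ← mul_assoc, ← T_add]
  congr 2
  push_cast
  ring

end Smoothing

theorem stateSum_crossing {D DA DB : LinkDiagram} {e : D.Dart} (he : e ∈ D.overDarts)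
    (hA : IsSmoothing D DA e) (hB : IsSmoothing D DB (D.rot e)) :
    D.stateSum = T 1 * DA.stateSum + T (-1) * DB.stateSum := by
  obtain ⟨f, hf⟩ := hA.exists_rotSmoothing
  obtain ⟨g, hg⟩ := hB.exists_rotSmoothing
  have hc := hf.atCrossing
  have o1 : D.rot e ∉ D.overDarts := by rw [D.overDarts_rot e hc]; exact not_not.2 he
  unfold stateSum
  rw [← Finset.sum_filter_add_sum_filter_not D.states (fun τ => D.rot (τ e) = e),
    Finset.mul_sum, Finset.mul_sum]
  congr 1
  · refine Finset.sum_equiv f.permCongr (fun τ => ?_) fun τ hτ => ?_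
    · rw [Finset.mem_filter, mem_states, mem_states, hf.isState_iff]
    · rw [Finset.mem_filter, mem_states] at hτ
      exact hf.weight_over hτ.1 hτ.2 he
  -- The channel through the corner after `e` and the one through the corner after `rot e` are the
  -- only two choices, and they exclude each other.
  · have key : ∀ τ, D.IsState τ → (D.rot (τ e) ≠ e ↔ D.rot (τ (D.rot e)) = D.rot e) := by
      intro τ hτ
      rw [D.rot.injective.eq_iff]
      constructor
      · intro h
        rw [← (hτ e).2.resolve_right h, (hτ e).1]
      · intro h
        refine IsState.not_both hc ?_
        rw [← (hτ (D.rot e)).1, h]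
    refine Finset.sum_equiv g.permCongr (fun τ => ?_) fun τ hτ => ?_
    · rw [Finset.mem_filter, mem_states, mem_states, hg.isState_iff]
      exact and_congr_right (key τ)
    · rw [Finset.mem_filter, mem_states] at hτ
      exact hg.weight_under hτ.1 ((key τ hτ.1).1 hτ.2) o1

theorem stateSum_empty (D : LinkDiagram) [IsEmpty D.Dart] : D.stateSum = 1 := by
  have hs : D.states = {1} := by
    ext τ
    simp only [mem_states, Finset.mem_singleton]
    exact iff_of_true (fun d => isEmptyElim d) (Subsingleton.elim _ _)
  have hL : ∀ τ, D.numLoops τ = 0 := fun τ => by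
    refine Nat.card_eq_zero.2 (Or.inl ⟨?_⟩)
    rintro ⟨d⟩
    exact isEmptyElim d
  have hE : ∀ s : Set D.Dart, s.ncard = 0 := fun s => by
    rw [Set.eq_empty_of_isEmpty s, Set.ncard_empty]
  simp [stateSum, hs, weight, hL, numA, numB, hE]

/-! ### The state sum under deleting a loop -/

section LoopRemoval

variable {D' : LinkDiagram} {i : D'.Dart → D.Dart}

/-- The part of a loop removal that concerns darts. -/
structure DartRemoval (D D' : LinkDiagram) (i : D'.Dart → D.Dart) : Prop where
  inj : Function.Injective i
  rot : ∀ d, i (D'.rot d) = D.rot (i d)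
  opp : ∀ d, i (D'.opp d) = D.opp (i d)
  overDarts : ∀ d, D'.AtCrossing d → (d ∈ D'.overDarts ↔ i d ∈ D.overDarts)
  component : ∃ K : D.Component, ∀ d, d ∉ Set.range i ↔ (Quot.mk _ d : D.Component) = K
  not_atCrossing : ∀ d, d ∉ Set.range i → ¬ D.AtCrossing d

theorem IsLoopRemoval.exists_dartRemoval (h : IsLoopRemoval D D') :
    ∃ i, DartRemoval D D' i := by
  obtain ⟨i, j, h1, -, h2, h3, h4, -, -, h5, h6, -⟩ := h
  exact ⟨i, h1, h2, h3, h4, h5, h6⟩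

theorem DartRemoval.mem_range_rot (h : DartRemoval D D' i) (d : D.Dart) :
    D.rot d ∈ Set.range i ↔ d ∈ Set.range i := by
  obtain ⟨K, hK⟩ := h.component
  rw [← not_iff_not, hK, hK, ← Quot.sound (r := fun a b => b = D.rot a ∨ b = D.opp a) (Or.inl rfl)]

theorem DartRemoval.mem_range_opp (h : DartRemoval D D' i) (d : D.Dart) :
    D.opp d ∈ Set.range i ↔ d ∈ Set.range i := by
  obtain ⟨K, hK⟩ := h.component
  rw [← not_iff_not, hK, hK, ← Quot.sound (r := fun a b => b = D.rot a ∨ b = D.opp a) (Or.inr rfl)]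

theorem IsState.mem_range (h : DartRemoval D D' i) {τ : Equiv.Perm D.Dart} (hτ : D.IsState τ)
    (d : D.Dart) : τ d ∈ Set.range i ↔ d ∈ Set.range i := by
  rcases (hτ d).2 with h1 | h1
  · rw [h1, h.mem_range_rot]
  · rw [← h.mem_range_rot, h1]

theorem DartRemoval.atCrossing_iff (h : DartRemoval D D' i) (d : D'.Dart) :
    D.AtCrossing (i d) ↔ D'.AtCrossing d := by
  unfold AtCrossing
  rw [← h.rot, ← h.rot, h.inj.ne_iff]

theorem DartRemoval.isState_extend (h : DartRemoval D D' i) {τ' : Equiv.Perm D'.Dart}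
    (hτ : D'.IsState τ') : ∃ τ, D.IsState τ ∧ ∀ d, τ (i d) = i (τ' d) := by
  -- On the deleted loop all vertices are bivalent, so the extension must be `rot` there.
  let t : D.Dart → D.Dart := fun d =>
    if hd : d ∈ Set.range i then i (τ' hd.choose) else D.rot d
  have ti : ∀ d, t (i d) = i (τ' d) := fun d => by
    have hd : i d ∈ Set.range i := ⟨d, rfl⟩
    refine (dif_pos hd).trans ?_
    rw [h.inj hd.choose_spec]
  have tn : ∀ d, d ∉ Set.range i → t d = D.rot d := fun d hd => dif_neg hd
  have ht : Function.Involutive t := by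
    intro d
    by_cases hd : d ∈ Set.range i
    · obtain ⟨x, rfl⟩ := hd
      rw [ti, ti, (hτ x).1]
    · rw [tn d hd, tn _ (by rwa [h.mem_range_rot])]
      exact not_not.1 (h.not_atCrossing d hd)
  refine ⟨ht.toPerm, fun d => ⟨ht d, ?_⟩, ti⟩
  change t d = _ ∨ D.rot (t d) = _
  by_cases hd : d ∈ Set.range i
  · obtain ⟨x, rfl⟩ := hd
    rw [ti, ← h.rot, ← h.rot, h.inj.eq_iff, h.inj.eq_iff]
    exact (hτ x).2
  · exact Or.inl (tn d hd)

theorem DartRemoval.isState_restrict (h : DartRemoval D D' i) {τ : Equiv.Perm D.Dart}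
    (hτ : D.IsState τ) : ∃ τ', D'.IsState τ' ∧ ∀ d, τ (i d) = i (τ' d) := by
  have hr : ∀ d, ∃ x, i x = τ (i d) := fun d => (hτ.mem_range h (i d)).2 ⟨d, rfl⟩
  choose t ht using hr
  have hi : Function.Involutive t := fun d => h.inj (by rw [ht, ht, (hτ _).1])
  refine ⟨hi.toPerm, fun d => ⟨hi d, ?_⟩, fun d => (ht d).symm⟩
  change t d = _ ∨ D'.rot (t d) = _
  rw [← h.inj.eq_iff, ← h.inj.eq_iff (a := D'.rot _), h.rot, h.rot, ht]
  exact (hτ _).2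

theorem DartRemoval.weight_eq (h : DartRemoval D D' i) {τ : Equiv.Perm D.Dart}
    (hτ : D.IsState τ) {τ' : Equiv.Perm D'.Dart} (hi : ∀ d, τ (i d) = i (τ' d)) :
    D.weight τ = (T 2 + T (-2)) * D'.weight τ' := by
  have hA : D.aDarts τ = i '' D'.aDarts τ' := by
    ext x
    by_cases hx : x ∈ Set.range i
    · obtain ⟨d, rfl⟩ := hx
      rw [h.inj.mem_set_image]
      simp only [aDarts, Set.mem_ofPred_eq, h.atCrossing_iff, hi, ← h.rot, h.inj.eq_iff]
      exact and_congr_right fun hc => by rw [h.overDarts d hc]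
    · refine iff_of_false (fun hd => h.not_atCrossing x hx hd.1) ?_
      rintro ⟨d, -, rfl⟩
      exact hx ⟨d, rfl⟩
  have hB : D.bDarts τ = i '' D'.bDarts τ' := by
    ext x
    by_cases hx : x ∈ Set.range i
    · obtain ⟨d, rfl⟩ := hx
      rw [h.inj.mem_set_image]
      simp only [bDarts, Set.mem_ofPred_eq, h.atCrossing_iff, hi, ← h.rot, h.inj.eq_iff]
      exact and_congr_right fun hc => by rw [h.overDarts d hc]
    · refine iff_of_false (fun hd => h.not_atCrossing x hx hd.1) ?_
      rintro ⟨d, -, rfl⟩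
      exact hx ⟨d, rfl⟩
  have hL : D.numLoops τ = D'.numLoops τ' + 1 := by
    obtain ⟨K, hK⟩ := h.component
    obtain ⟨k, rfl⟩ := Quot.exists_rep K
    refine card_quot_eq_card_quot_add_one h.inj (fun x y => ?_) ?_ ((hK k).2 rfl) fun x hx => ?_
    · rw [hi, ← h.opp, h.inj.eq_iff, h.inj.eq_iff]
    · rintro x _ (rfl | rfl)
      · rw [hτ.mem_range h]
      · rw [h.mem_range_opp]
    -- Since `τ` agrees with `rot` off the range of `i`, the deleted component is a single loop of
    -- the state.
    · have key : ∀ a b, Relation.EqvGen (fun a b => b = D.rot a ∨ b = D.opp a) a b →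
          (a ∈ Set.range i ↔ b ∈ Set.range i) ∧
          (a ∉ Set.range i → Relation.EqvGen (fun a b => b = τ a ∨ b = D.opp a) a b) := by
        intro a b hab
        induction hab with
        | rel a b hab =>
          rcases hab with rfl | rfl
          · refine ⟨(h.mem_range_rot a).symm, fun ha => .rel _ _ (Or.inl ?_)⟩
            rw [hτ.eq_rot (h.not_atCrossing a ha)]
          · exact ⟨(h.mem_range_opp a).symm, fun ha => .rel _ _ (Or.inr rfl)⟩
        | refl a => exact ⟨Iff.rfl, fun _ => .refl a⟩
        | symm a b _ ih => exact ⟨ih.1.symm, fun hb => .symm _ _ (ih.2 fun ha => hb (ih.1.1 ha))⟩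
        | trans a b c _ _ ih1 ih2 =>
          exact ⟨ih1.1.trans ih2.1, fun ha => .trans _ _ _ (ih1.2 ha)
            (ih2.2 fun hb => ha (ih1.1.2 hb))⟩
      exact (key k x (Quot.eqvGen_exact ((hK x).1 hx).symm)).2 ((hK k).2 rfl)
  rw [weight, weight, hL, numA, numB, numA, numB, hA, hB, Set.ncard_image_of_injective _ h.inj,
    Set.ncard_image_of_injective _ h.inj]
  ring

end LoopRemoval

theorem stateSum_loop {D D' : LinkDiagram} (h : IsLoopRemoval D D') :
    D.stateSum = (T 2 + T (-2)) * D'.stateSum := by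
  obtain ⟨i, hi⟩ := h.exists_dartRemoval
  unfold stateSum
  rw [Finset.mul_sum]
  symm
  refine Finset.sum_bij (fun τ' hτ => (hi.isState_extend (mem_states.1 hτ)).choose)
    (fun τ' hτ => mem_states.2 (hi.isState_extend (mem_states.1 hτ)).choose_spec.1) ?_ ?_ ?_
  · intro a ha b hb hab
    ext d
    apply hi.inj
    rw [← (hi.isState_extend (mem_states.1 ha)).choose_spec.2,
      ← (hi.isState_extend (mem_states.1 hb)).choose_spec.2, hab]
  · intro τ hτ
    obtain ⟨τ', h1, h2⟩ := hi.isState_restrict (mem_states.1 hτ)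
    refine ⟨τ', mem_states.2 h1, ?_⟩
    have hs := (hi.isState_extend h1).choose_spec
    ext d
    by_cases hd : d ∈ Set.range i
    · obtain ⟨x, rfl⟩ := hd
      rw [hs.2, h2]
    · rw [hs.1.eq_rot (hi.not_atCrossing d hd),
        (mem_states.1 hτ).eq_rot (hi.not_atCrossing d hd)]
  · intro τ' hτ
    have hs := (hi.isState_extend (mem_states.1 hτ)).choose_spec
    exact (hi.weight_eq hs.1 hs.2).symm

/-- The state sum satisfies the defining rules of the bracket. -/
theorem isPositiveBracket_stateSum : IsPositiveBracket stateSum where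
  empty D _ := D.stateSum_empty
  loop _ _ h := stateSum_loop h
  crossing _ _ _ _ he hA hB := stateSum_crossing he hA hB

end LinkDiagram

/-! ### Bounds on exponents -/

namespace LaurentPolynomial

/-- All exponents of `f` lie between `lo` and `hi`. -/
def ExponentsIn (f : LaurentPolynomial ℤ) (lo hi : ℤ) : Prop :=
  ∀ m ∈ f.coeff.support, lo ≤ m ∧ m ≤ hi

theorem ExponentsIn.mono {f : LaurentPolynomial ℤ} {lo hi lo' hi' : ℤ} (h : f.ExponentsIn lo hi)
    (h1 : lo' ≤ lo) (h2 : hi ≤ hi') : f.ExponentsIn lo' hi' := fun m hm =>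
  ⟨h1.trans (h m hm).1, (h m hm).2.trans h2⟩

theorem exponentsIn_T (n : ℤ) : (T n : LaurentPolynomial ℤ).ExponentsIn n n := by
  intro m hm
  rw [Finsupp.mem_support_iff, T_apply] at hm
  have : n = m := by by_contra h; simp [h] at hm
  omega

theorem ExponentsIn.add {f g : LaurentPolynomial ℤ} {lo hi : ℤ} (hf : f.ExponentsIn lo hi)
    (hg : g.ExponentsIn lo hi) : (f + g).ExponentsIn lo hi := by
  classical
  intro m hm
  rw [AddMonoidAlgebra.coeff_add] at hm
  rcases Finset.mem_union.1 (Finsupp.support_add hm) with h | h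
  exacts [hf m h, hg m h]

theorem ExponentsIn.sum {ι : Type*} {s : Finset ι} {f : ι → LaurentPolynomial ℤ} {lo hi : ℤ}
    (h : ∀ i ∈ s, (f i).ExponentsIn lo hi) : (∑ i ∈ s, f i).ExponentsIn lo hi := by
  classical
  induction s using Finset.induction_on with
  | empty => intro m hm; simp at hm
  | insert a s ha ih =>
    rw [Finset.sum_insert ha]
    exact (h a (Finset.mem_insert_self a s)).add
      (ih fun i hi => h i (Finset.mem_insert_of_mem hi))

theorem ExponentsIn.mul {f g : LaurentPolynomial ℤ} {a b c d : ℤ} (hf : f.ExponentsIn a b)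
    (hg : g.ExponentsIn c d) : (f * g).ExponentsIn (a + c) (b + d) := by
  classical
  intro m hm
  obtain ⟨x, hx, y, hy, rfl⟩ := Finset.mem_add.1 (AddMonoidAlgebra.support_coeff_mul_subset f g hm)
  have := hf x hx
  have := hg y hy
  omega

theorem exponentsIn_loop_pow (k : ℕ) :
    ((T 2 + T (-2) : LaurentPolynomial ℤ) ^ k).ExponentsIn (-2 * k) (2 * k) := by
  induction k with
  | zero => simpa using exponentsIn_T 0
  | succ k ih =>
    rw [pow_succ]
    refine (ih.mul (((exponentsIn_T 2).mono (lo' := -2) (by omega) le_rfl).add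
      ((exponentsIn_T (-2)).mono le_rfl (by omega)))).mono ?_ ?_ <;> push_cast <;> omega

theorem ExponentsIn.totalSpan_le {f : LaurentPolynomial ℤ} {lo hi : ℤ} (h : f.ExponentsIn lo hi)
    (hf : f ≠ 0) : f.totalSpan ≤ hi - lo := by
  have hs : f.coeff.support.Nonempty := by
    rwa [Finsupp.support_nonempty_iff, Ne, AddMonoidAlgebra.coeff_eq_zero]
  rw [totalSpan, dif_pos hs]
  have h1 := h _ (Finset.max'_mem _ hs)
  have h2 := h _ (Finset.min'_mem _ hs)
  omega

end LaurentPolynomial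

/-- Two linear maps with orthogonal ranges. -/
theorem finrank_range_add_finrank_range_le {K ι κ ν : Type*} [Field K] [Fintype ι] [Fintype κ]
    [Fintype ν] [DecidableEq κ] [DecidableEq ν] (f : (κ → K) →ₗ[K] (ι → K))
    (g : (ν → K) →ₗ[K] (ι → K)) (h : ∀ x y, ∑ i, f x i * g y i = 0) :
    Module.finrank K (LinearMap.range f) + Module.finrank K (LinearMap.range g) ≤
      Fintype.card ι := by
  have h1 : (LinearMap.toMatrix' f).transpose * LinearMap.toMatrix' g = 0 := by
    ext i j
    simp only [Matrix.mul_apply, Matrix.transpose_apply, LinearMap.toMatrix'_apply,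
      Matrix.zero_apply]
    exact h _ _
  -- Unlike in `euler_inequality`, the two ranges may intersect, since over a general field a
  -- nonzero vector can be self-orthogonal. The rank bound for a vanishing product still applies.
  have h2 := Matrix.rank_add_rank_le_card_of_mul_eq_zero h1
  rw [Matrix.rank_transpose] at h2
  have hf : (LinearMap.toMatrix' f).rank = Module.finrank K (LinearMap.range f) := by
    rw [Matrix.rank, ← Matrix.toLin'_apply', Matrix.toLin'_toMatrix']
  have hg : (LinearMap.toMatrix' g).rank = Module.finrank K (LinearMap.range g) := by
    rw [Matrix.rank, ← Matrix.toLin'_apply', Matrix.toLin'_toMatrix']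
  rwa [hf, hg] at h2

/-! ### Comparing loop counts of states -/

namespace LinkDiagram

open Classical LaurentPolynomial

variable {D : LinkDiagram}

theorem IsState.eq_rot_iff {τ : Equiv.Perm D.Dart} (h : D.IsState τ) {e : D.Dart}
    (he : D.AtCrossing e) : τ e = D.rot e ↔ ¬ D.rot (τ e) = e :=
  ⟨IsState.not_both he, (h e).2.resolve_right⟩

theorem IsState.apply_eq' {τ : Equiv.Perm D.Dart} (h : D.IsState τ) {e : D.Dart}
    (he : D.AtCrossing e) (h1 : τ e = D.rot e) :
    τ (D.rot e) = e ∧ τ (D.rot (D.rot e)) = D.rot (D.rot (D.rot e)) ∧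
      τ (D.rot (D.rot (D.rot e))) = D.rot (D.rot e) := by
  have h2 := h.rot_eq_rot_rot he h1
  exact ⟨by rw [← h1, (h e).1], h2, by rw [← h2, (h _).1]⟩

/-- States that differ at a half-edge differ at the next one. -/
theorem IsState.ne_rot {τ σ : Equiv.Perm D.Dart} (hτ : D.IsState τ) (hσ : D.IsState σ)
    {e : D.Dart} (he : D.AtCrossing e) (h : τ e ≠ σ e) : τ (D.rot e) ≠ σ (D.rot e) := by
  rcases (hτ e).2 with h1 | h1 <;> rcases (hσ e).2 with h2 | h2
  · exact absurd (h1.trans h2.symm) h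
  · rw [(hτ.apply_eq' he h1).1, (hσ.apply_eq he h2).2.1]
    exact he.symm
  · rw [(hσ.apply_eq' he h2).1, (hτ.apply_eq he h1).2.1]
    exact he
  · exact absurd (D.rot.injective (h1.trans h2.symm)) h

/-- The half-edges at a crossing are joined by any two states that differ there. -/
theorem IsState.eqvGen_of_ne {τ σ : Equiv.Perm D.Dart} (hτ : D.IsState τ) (hσ : D.IsState σ)
    {e : D.Dart} (he : D.AtCrossing e) (h : τ e ≠ σ e) {R : D.Dart → D.Dart → Prop}
    (hR : Equivalence R) (h1 : ∀ d, R d (τ d)) (h2 : R e (σ e)) {y : D.Dart}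
    (hy : D.OfVertex e y) : R e y := by
  rcases (hτ e).2 with h3 | h3
  · have h4 : D.rot (σ e) = e := by
      by_contra h4
      exact h (h3.trans ((hσ.eq_rot_iff he).2 h4).symm)
    obtain ⟨k1, k2, k3⟩ := hτ.apply_eq' he h3
    have h5 := D.rot_eq_iff.1 h4
    rcases hy with rfl | rfl | rfl | rfl
    · exact hR.refl _
    · exact h3 ▸ h1 _
    · exact hR.trans (h5 ▸ h2) (by simpa only [k3] using h1 (D.rot (D.rot (D.rot e))))
    · exact h5 ▸ h2
  · have h4 : σ e = D.rot e := by
      by_contra h4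
      exact h (D.rot.injective (h3.trans ((hσ e).2.resolve_left h4).symm))
    obtain ⟨k0, k1, k2, k3⟩ := hτ.apply_eq he h3
    rcases hy with rfl | rfl | rfl | rfl
    · exact hR.refl _
    · exact h4 ▸ h2
    · exact hR.trans (h4 ▸ h2) (k1 ▸ h1 (D.rot e))
    · exact k0 ▸ h1 e

/-- The numbers of loops of two states differ by at most the number of crossings where the states
differ. -/
theorem numLoops_le_add {τ σ : Equiv.Perm D.Dart} (hτ : D.IsState τ) (hσ : D.IsState σ) :
    D.numLoops τ ≤ D.numLoops σ +
      {d | D.AtCrossing d ∧ d ∈ D.overDarts ∧ τ d ≠ σ d}.ncard / 2 := by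
  set X : Set D.Dart := {d | D.AtCrossing d ∧ d ∈ D.overDarts ∧ τ d ≠ σ d}
  -- `S` picks one of the two opposite over-darts at each crossing where the states differ.
  obtain ⟨S, hSX, hS, hcov⟩ := Finset.exists_transversal_of_involution
    (fun d => D.rot (D.rot d)) D.rot_four X.toFinset
    (by
      intro d hd
      rw [Set.mem_toFinset] at hd ⊢
      have hc := D.atCrossing_rot.2 hd.1
      exact ⟨D.atCrossing_rot.2 hc, (D.overDarts_rot_rot hd.1).2 hd.2.1,
        hτ.ne_rot hσ hc (hτ.ne_rot hσ hd.1 hd.2.2)⟩)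
    (by
      intro d hd
      rw [Set.mem_toFinset] at hd
      exact hd.1)
  have hS' : X.ncard / 2 = S.card := by
    rw [Set.ncard_eq_toFinset_card', ← hS]
    omega
  rw [hS']
  -- One extra identification per differing crossing joins all four half-edges there, so the
  -- enlarged relation contains that of `σ`.
  let P : Finset (D.Dart × D.Dart) := S.image fun d => (d, σ d)
  have hP : P.card ≤ S.card := Finset.card_image_le
  refine (card_quot_le_card_quot_or_mem (fun a b => b = τ a ∨ b = D.opp a) P).trans
    (Nat.add_le_add ?_ hP)
  refine card_quot_le_of_eqvGen ?_
  set R : D.Dart → D.Dart → Prop := fun x y => (y = τ x ∨ y = D.opp x) ∨ (x, y) ∈ P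
  rintro y _ (rfl | rfl)
  · by_cases hy : τ y = σ y
    · exact .rel _ _ (Or.inl (Or.inl hy.symm))
    · have hc : D.AtCrossing y := by
        by_contra hc
        exact hy (by rw [hτ.eq_rot hc, hσ.eq_rot hc])
      have key : ∀ x ∈ X, D.OfVertex x y → D.OfVertex x (σ y) →
          Relation.EqvGen R y (σ y) := by
        have key' : ∀ z ∈ S, D.OfVertex z y → D.OfVertex z (σ y) →
            Relation.EqvGen R y (σ y) := by
          intro z hz h1 h2
          obtain ⟨hc, -, hne⟩ := Set.mem_toFinset.1 (hSX hz)
          have hj : ∀ {w}, D.OfVertex z w → Relation.EqvGen R z w := fun hw =>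
            hτ.eqvGen_of_ne hσ hc hne (Relation.EqvGen.is_equivalence R)
              (fun d => .rel _ _ (Or.inl (Or.inl rfl)))
              (.rel _ _ (Or.inr (Finset.mem_image.2 ⟨z, hz, rfl⟩))) hw
          exact (hj h1).symm.trans _ _ _ (hj h2)
        intro x hx h1 h2
        rcases hcov x (Set.mem_toFinset.2 hx) with h | h
        · exact key' x h h1 h2
        · have hv : ∀ w, D.OfVertex x w → D.OfVertex (D.rot (D.rot x)) w := by
            intro w hw
            rw [← vertex_mk_eq_iff] at hw ⊢
            rw [← hw, vertex_mk_eq_iff]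
            exact Or.inr (Or.inr (Or.inl (D.rot_four x).symm))
          exact key' _ h (hv _ h1) (hv _ h2)
      have hv : D.OfVertex y (σ y) := by
        rcases (hσ y).2 with h | h
        · exact Or.inr (Or.inl h)
        · exact Or.inr (Or.inr (Or.inr (D.rot_eq_iff.1 h)))
      by_cases ho : y ∈ D.overDarts
      · exact key y ⟨hc, ho, hy⟩ (Or.inl rfl) hv
      · have hv' : ∀ w, D.OfVertex y w → D.OfVertex (D.rot y) w := by
          intro w hw
          rw [← vertex_mk_eq_iff] at hw ⊢
          rw [← hw, vertex_mk_eq_iff]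
          exact Or.inr (Or.inr (Or.inr (D.rot_four y).symm))
        exact key _ ⟨D.atCrossing_rot.2 hc, (D.overDarts_rot y hc).2 ho, hτ.ne_rot hσ hc hy⟩
          (hv' _ (Or.inl rfl)) (hv' _ hv)
  · exact .rel _ _ (Or.inl (Or.inr rfl))

/-- A set that contains every second half-edge at each crossing determines a state. -/
theorem exists_isState_of_alternating (S : Set D.Dart)
    (hS : ∀ d, D.AtCrossing d → (D.rot d ∈ S ↔ d ∉ S)) :
    ∃ τ, D.IsState τ ∧ ∀ d, D.AtCrossing d → (d ∈ S ↔ D.rot (τ d) = d) := by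
  let t : D.Dart → D.Dart := fun d =>
    if D.AtCrossing d ∧ d ∈ S then D.rot (D.rot (D.rot d)) else D.rot d
  have tp : ∀ d, D.AtCrossing d → d ∈ S → t d = D.rot (D.rot (D.rot d)) := fun d h1 h2 =>
    if_pos ⟨h1, h2⟩
  have tn : ∀ d, ¬ (D.AtCrossing d ∧ d ∈ S) → t d = D.rot d := fun d h => if_neg h
  have ht : Function.Involutive t := by
    intro d
    by_cases hc : D.AtCrossing d
    · by_cases hd : d ∈ S
      · have hc3 : D.AtCrossing (D.rot (D.rot (D.rot d))) := by
          simpa only [atCrossing_rot] using hc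
        rw [tp d hc hd, tn, D.rot_four]
        rintro ⟨-, h⟩
        have := hS _ hc3
        rw [D.rot_four] at this
        exact this.1 hd h
      · rw [tn d fun h => hd h.2, tp _ (D.atCrossing_rot.2 hc) ((hS d hc).2 hd), D.rot_four]
    · rw [tn d fun h => hc h.1, tn _ fun h => hc (D.atCrossing_rot.1 h.1)]
      exact not_not.1 hc
  have hs : D.IsState ht.toPerm := by
    refine fun d => ⟨ht d, ?_⟩
    change t d = _ ∨ D.rot (t d) = d
    by_cases h : D.AtCrossing d ∧ d ∈ S
    · exact Or.inr (by rw [tp d h.1 h.2, D.rot_four])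
    · exact Or.inl (tn d h)
  refine ⟨ht.toPerm, hs, fun d hc => ?_⟩
  by_cases h : d ∈ S
  · refine iff_of_true h ?_
    change D.rot (t d) = d
    rw [tp d hc h, D.rot_four]
  · exact iff_of_false h (IsState.not_both hc (tn d fun h' => h h'.2))

theorem exists_isState_allA (D : LinkDiagram) :
    ∃ τ, D.IsState τ ∧ ∀ d, D.AtCrossing d → (d ∈ D.overDarts ↔ D.rot (τ d) = d) :=
  exists_isState_of_alternating D.overDarts fun d hd => D.overDarts_rot d hd

theorem exists_isState_allB (D : LinkDiagram) :
    ∃ τ, D.IsState τ ∧ ∀ d, D.AtCrossing d → (d ∉ D.overDarts ↔ D.rot (τ d) = d) :=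
  exists_isState_of_alternating D.overDartsᶜ fun d hd => by
    rw [Set.mem_compl_iff, Set.mem_compl_iff, D.overDarts_rot d hd]

/-- The over-darts where `τ` departs from the all-$A$ state are `B`-smoothed. -/
theorem numLoops_le_allA {τ σ : Equiv.Perm D.Dart} (hτ : D.IsState τ) (hσ : D.IsState σ)
    (h : ∀ d, D.AtCrossing d → (d ∈ D.overDarts ↔ D.rot (σ d) = d)) :
    D.numLoops τ ≤ D.numLoops σ + D.numB τ := by
  refine (numLoops_le_add hτ hσ).trans (Nat.add_le_add_left (Nat.div_le_div_right ?_) _)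
  refine Set.ncard_le_ncard fun d hd => ⟨hd.1, hd.2.1, ?_⟩
  rw [hτ.eq_rot_iff hd.1]
  exact fun h1 => hd.2.2 (D.rot.injective (h1.trans ((h d hd.1).1 hd.2.1).symm))

theorem numLoops_le_allB {τ σ : Equiv.Perm D.Dart} (hτ : D.IsState τ) (hσ : D.IsState σ)
    (h : ∀ d, D.AtCrossing d → (d ∉ D.overDarts ↔ D.rot (σ d) = d)) :
    D.numLoops τ ≤ D.numLoops σ + D.numA τ := by
  refine (numLoops_le_add hτ hσ).trans (Nat.add_le_add_left (Nat.div_le_div_right ?_) _)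
  refine Set.ncard_le_ncard fun d hd => ⟨hd.1, hd.2.1, ?_⟩
  refine (hτ d).2.resolve_left fun h1 => hd.2.2 (h1.trans ?_)
  exact ((hσ.eq_rot_iff hd.1).2 fun h2 => (h d hd.1).2 h2 hd.2.1).symm

/-- The crossings of a diagram. -/
def Crossing (D : LinkDiagram) : Type :=
  {v : D.Vertex // ∃ d, D.AtCrossing d ∧ Quot.mk _ d = v}

instance : Finite D.Crossing := inferInstanceAs (Finite (Subtype _))
noncomputable instance : Fintype D.Crossing := Fintype.ofFinite _

theorem numCrossings_eq (D : LinkDiagram) : D.numCrossings = Fintype.card D.Crossing :=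
  Nat.card_eq_fintype_card (α := D.Crossing)

/-- A half-edge at a crossing. -/
noncomputable def Crossing.dart (c : D.Crossing) : D.Dart := c.2.choose

theorem Crossing.atCrossing_dart (c : D.Crossing) : D.AtCrossing c.dart := c.2.choose_spec.1

theorem Crossing.mk_dart (c : D.Crossing) : Quot.mk _ c.dart = c.1 := c.2.choose_spec.2

/-- The crossing of a half-edge. -/
def crossingOf (d : {d : D.Dart // D.AtCrossing d}) : D.Crossing := ⟨Quot.mk _ d.1, d.1, d.2, rfl⟩

theorem crossingOf_eq_iff (d : {d : D.Dart // D.AtCrossing d}) (c : D.Crossing) :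
    crossingOf d = c ↔ D.OfVertex c.dart d.1 := by
  rw [← vertex_mk_eq_iff, c.mk_dart, eq_comm]
  exact Subtype.ext_iff

theorem numA_add_numB_le (τ : Equiv.Perm D.Dart) : D.numA τ + D.numB τ ≤ D.numCrossings := by
  have h1 : (D.aDarts τ).ncard + (D.bDarts τ).ncard ≤
      Nat.card {d // D.AtCrossing d ∧ d ∈ D.overDarts} := by
    rw [← Set.ncard_union_eq]
    · exact Set.ncard_le_ncard (t := {d | D.AtCrossing d ∧ d ∈ D.overDarts}) fun d hd => by
        rcases hd with hd | hd <;> exact ⟨hd.1, hd.2.1⟩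
    · rw [Set.disjoint_left]
      exact fun d ha hb => IsState.not_both ha.1 hb.2.2 ha.2.2
  have h2 : Nat.card {d // D.AtCrossing d ∧ d ∈ D.overDarts} ≤ Nat.card (D.Crossing × Bool) := by
    let c : {d // D.AtCrossing d ∧ d ∈ D.overDarts} → D.Crossing := fun d =>
      crossingOf ⟨d.1, d.2.1⟩
    -- Over-darts are opposite, so exactly one of the two at a crossing lies in the chosen pair of
    -- adjacent half-edges.
    refine Nat.card_le_card_of_injective (fun d => (c d,
      decide (d.1 = (c d).dart ∨ d.1 = D.rot (c d).dart))) ?_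
    intro x y hxy
    rw [Prod.mk.injEq, decide_eq_decide] at hxy
    obtain ⟨h1, h2⟩ := hxy
    have hx := (crossingOf_eq_iff ⟨x.1, x.2.1⟩ (c x)).1 rfl
    have hy := (crossingOf_eq_iff ⟨y.1, y.2.1⟩ (c y)).1 rfl
    rw [← h1] at h2 hy
    have hc := (c x).atCrossing_dart
    have ox := x.2.2
    have oy := y.2.2
    generalize (c x).dart = e at *
    obtain ⟨d1, d2, d3, d4, d5, d6⟩ := hc.distinct
    have o1 := D.overDarts_rot e hc
    have o2 := D.overDarts_rot_rot hc
    have o3 := D.overDarts_rot_rot (D.atCrossing_rot.2 hc)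
    apply Subtype.ext
    dsimp only at hx hy
    simp only [OfVertex] at hx hy
    grind
  rw [Nat.card_prod, Nat.card_eq_fintype_card (α := D.Crossing), ← numCrossings_eq] at h2
  simp only [Nat.card_eq_fintype_card (α := Bool), Fintype.card_bool] at h2
  unfold numA numB
  omega

/-! ### The dual state lemma -/

section DualState

/-- The difference modulo 2 of the values of a function on the loops of a state at the two opposite
half-edges of each crossing. -/
noncomputable def cornerDifference (D : LinkDiagram) (σ : Equiv.Perm D.Dart) :
    ((Quot fun a b => b = σ a ∨ b = D.opp a) → ZMod 2) →ₗ[ZMod 2] (D.Crossing → ZMod 2) :=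
  LinearMap.funLeft _ _ (fun c => Quot.mk _ c.dart) +
    LinearMap.funLeft _ _ (fun c => Quot.mk _ (D.rot (D.rot c.dart)))

theorem cornerDifference_apply (σ : Equiv.Perm D.Dart) (g) (c : D.Crossing) :
    D.cornerDifference σ g c = g (Quot.mk _ c.dart) + g (Quot.mk _ (D.rot (D.rot c.dart))) := rfl

/-- The half-edges `c.dart` and its opposite lie on the two different arcs of `σ` at `c`. Equality
there makes a function constant around every crossing, so it descends to components. -/
theorem finrank_ker_cornerDifference_le {σ : Equiv.Perm D.Dart} (hσ : D.IsState σ) :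
    Module.finrank (ZMod 2) (LinearMap.ker (D.cornerDifference σ)) ≤ D.numComponents := by
  have := Fintype.ofFinite D.Component
  have := Fintype.ofFinite (Quot fun a b => b = σ a ∨ b = D.opp a)
  let p : (Quot fun a b => b = σ a ∨ b = D.opp a) → D.Component :=
    Quot.lift (Quot.mk _) (by
      have h : ∀ a : D.Dart, (Quot.mk _ a : D.Component) = Quot.mk _ (D.rot a) := fun a =>
        Quot.sound (Or.inl rfl)
      rintro a b (hb | hb)
      · rcases (hσ a).2 with h1 | h1
        · rw [hb, h1, ← h]
        · rw [hb, h (σ a), h1]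
      · exact Quot.sound (Or.inr hb))
  calc Module.finrank (ZMod 2) (LinearMap.ker (D.cornerDifference σ))
      ≤ Module.finrank (ZMod 2) (LinearMap.range (LinearMap.funLeft (ZMod 2) (ZMod 2) p)) := by
        refine Submodule.finrank_mono fun g hg => ?_
        have hσg : ∀ d, g (Quot.mk _ (σ d)) = g (Quot.mk _ d) := fun d =>
          congrArg g (Quot.sound (r := fun a b => b = σ a ∨ b = D.opp a) (Or.inl rfl)).symm
        have hopp : ∀ d, g (Quot.mk _ (D.opp d)) = g (Quot.mk _ d) := fun d =>
          congrArg g (Quot.sound (r := fun a b => b = σ a ∨ b = D.opp a) (Or.inr rfl)).symm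
        have hcorner : ∀ c : D.Crossing,
            g (Quot.mk _ (D.rot (D.rot c.dart))) = g (Quot.mk _ c.dart) := fun c => by
          have := congrFun (LinearMap.mem_ker.1 hg) c
          rw [cornerDifference_apply, Pi.zero_apply, CharTwo.add_eq_zero] at this
          exact this.symm
        have hall : ∀ (c : D.Crossing) (d), D.OfVertex c.dart d →
            g (Quot.mk _ d) = g (Quot.mk _ c.dart) := by
          intro c d hd
          have hc := hcorner c
          have s0 := hσg c.dart
          have s2 := hσg (D.rot (D.rot c.dart))
          rcases (hσ c.dart).2 with h1 | h1
          · obtain ⟨k1, k2, k3⟩ := hσ.apply_eq' c.atCrossing_dart h1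
            rw [h1] at s0
            rw [k2] at s2
            rcases hd with rfl | rfl | rfl | rfl
            exacts [rfl, s0, hc, s2.trans hc]
          · obtain ⟨k0, k1, k2, k3⟩ := hσ.apply_eq c.atCrossing_dart h1
            rw [k0] at s0
            rw [k2] at s2
            rcases hd with rfl | rfl | rfl | rfl
            exacts [rfl, s2.trans hc, hc, s0]
        have hrot : ∀ d, g (Quot.mk _ (D.rot d)) = g (Quot.mk _ d) := by
          intro d
          by_cases hd : D.AtCrossing d
          · have hv := (crossingOf_eq_iff ⟨d, hd⟩ _).1 rfl
            rw [hall _ _ hv, hall _ _ ((D.ofVertex_rot).2 hv)]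
          · rw [← hσ.eq_rot hd, hσg]
        refine ⟨Quot.lift (fun d => g (Quot.mk _ d)) ?_, ?_⟩
        · rintro a b (rfl | rfl)
          · exact (hrot a).symm
          · exact (hopp a).symm
        · funext x
          obtain ⟨d, rfl⟩ := Quot.exists_rep x
          rfl
    _ ≤ Module.finrank (ZMod 2) (D.Component → ZMod 2) := LinearMap.finrank_range_le _
    _ = D.numComponents := by
        rw [Module.finrank_fintype_fun_eq_card, numComponents, Nat.card_eq_fintype_card]

/-- The function `F = g·h` on half-edges takes equal values at both ends of an edge, so its total is
zero mod 2. Bivalent vertices cancel likewise, and each crossing contributes one of the products in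
the sum. -/
theorem sum_cornerDifference_mul {σ σ' : Equiv.Perm D.Dart} (hσ : D.IsState σ)
    (hσ' : D.IsState σ') (hne : ∀ d, D.AtCrossing d → σ d ≠ σ' d) (g h) :
    ∑ c, D.cornerDifference σ g c * D.cornerDifference σ' h c = 0 := by
  let F : D.Dart → ZMod 2 := fun d => g (Quot.mk _ d) * h (Quot.mk _ d)
  have hg : ∀ d, g (Quot.mk _ (σ d)) = g (Quot.mk _ d) := fun d =>
    congrArg g (Quot.sound (r := fun a b => b = σ a ∨ b = D.opp a) (Or.inl rfl)).symm
  have hh : ∀ d, h (Quot.mk _ (σ' d)) = h (Quot.mk _ d) := fun d =>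
    congrArg h (Quot.sound (r := fun a b => b = σ' a ∨ b = D.opp a) (Or.inl rfl)).symm
  have hopp : ∀ d, F (D.opp d) = F d := fun d => by
    simp only [F]
    rw [← Quot.sound (r := fun a b => b = σ a ∨ b = D.opp a) (Or.inr rfl),
      ← Quot.sound (r := fun a b => b = σ' a ∨ b = D.opp a) (Or.inr rfl)]
  have hall : ∑ d, F d = 0 :=
    Finset.sum_involution (fun d _ => D.opp d)
      (fun d _ => by rw [hopp, CharTwo.add_self_eq_zero]) (fun d _ _ => D.opp_ne d)
      (fun d _ => Finset.mem_univ _) (fun d _ => D.opp_opp d)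
  have hbiv : ∑ d ∈ Finset.univ.filter (fun d => ¬ D.AtCrossing d), F d = 0 := by
    refine Finset.sum_involution (fun d _ => D.rot d) (fun d hd => ?_) (fun d _ _ => D.rot_ne d)
      (fun d hd => ?_) (fun d hd => ?_) <;> rw [Finset.mem_filter] at hd
    · have : F (D.rot d) = F d := by
        have h1 := hg d
        have h2 := hh d
        rw [hσ.eq_rot hd.2] at h1
        rw [hσ'.eq_rot hd.2] at h2
        simp only [F, h1, h2]
      rw [this, CharTwo.add_self_eq_zero]
    · rw [Finset.mem_filter, atCrossing_rot]
      exact ⟨Finset.mem_univ _, hd.2⟩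
    · exact not_not.1 hd.2
  have hcr : ∑ d ∈ Finset.univ.filter D.AtCrossing, F d = 0 := by
    have := Finset.sum_filter_add_sum_filter_not Finset.univ D.AtCrossing F
    rwa [hall, hbiv, add_zero] at this
  rw [← hcr, ← Finset.sum_subtype_eq_sum_filter, Finset.subtype_univ,
    ← Finset.sum_fiberwise _ crossingOf]
  refine Finset.sum_congr rfl fun c _ => ?_
  have hc := c.atCrossing_dart
  have hc1 := D.atCrossing_rot.2 hc
  have hc2 := D.atCrossing_rot.2 hc1
  have hc3 := D.atCrossing_rot.2 hc2
  have hfib : Finset.univ.filter (fun d => crossingOf d = c) =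
      {⟨_, hc⟩, ⟨_, hc1⟩, ⟨_, hc2⟩, ⟨_, hc3⟩} := by
    ext d
    simp only [Finset.mem_filter, Finset.mem_univ, true_and, crossingOf_eq_iff,
      Finset.mem_insert, Finset.mem_singleton, Subtype.ext_iff]
    rfl
  obtain ⟨d1, d2, d3, d4, d5, d6⟩ := hc.distinct
  rw [hfib, Finset.sum_insert (by simp [Subtype.ext_iff, d1, d2, d3]),
    Finset.sum_insert (by simp [Subtype.ext_iff, d4, d5]),
    Finset.sum_insert (by simp [Subtype.ext_iff, d6]), Finset.sum_singleton]
  simp only [F, cornerDifference_apply]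
  have g0 := hg c.dart
  have g2 := hg (D.rot (D.rot c.dart))
  have h0 := hh c.dart
  have h2 := hh (D.rot (D.rot c.dart))
  -- As the states are dual, `g` and `h` pair the four half-edges in the two different ways, so all
  -- four products of an arc value of `g` with one of `h` occur once.
  rcases (hσ c.dart).2 with e1 | e1
  · have e2 : D.rot (σ' c.dart) = c.dart := by
      by_contra h4
      exact hne _ hc (e1.trans ((hσ'.eq_rot_iff hc).2 h4).symm)
    obtain ⟨k1, k2, k3⟩ := hσ.apply_eq' hc e1
    obtain ⟨l0, l1, l2, l3⟩ := hσ'.apply_eq hc e2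
    rw [e1] at g0
    rw [k2] at g2
    rw [l0] at h0
    rw [l2] at h2
    rw [g0, g2, h0, h2]
    ring
  · have e2 : σ' c.dart = D.rot c.dart := by
      by_contra h4
      exact hne _ hc (D.rot.injective (e1.trans ((hσ' _).2.resolve_left h4).symm))
    obtain ⟨k1, k2, k3⟩ := hσ'.apply_eq' hc e2
    obtain ⟨l0, l1, l2, l3⟩ := hσ.apply_eq hc e1
    rw [e2] at h0
    rw [k2] at h2
    rw [l0] at g0
    rw [l2] at g2
    rw [g0, g2, h0, h2]
    ring

/-- The dual state lemma. -/
theorem numLoops_add_numLoops_le {σ σ' : Equiv.Perm D.Dart} (hσ : D.IsState σ)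
    (hσ' : D.IsState σ') (hne : ∀ d, D.AtCrossing d → σ d ≠ σ' d) :
    D.numLoops σ + D.numLoops σ' ≤ D.numCrossings + 2 * D.numComponents := by
  have := Fintype.ofFinite (Quot fun a b => b = σ a ∨ b = D.opp a)
  have := Fintype.ofFinite (Quot fun a b => b = σ' a ∨ b = D.opp a)
  have h1 := finrank_range_add_finrank_range_le (D.cornerDifference σ) (D.cornerDifference σ')
    (sum_cornerDifference_mul hσ hσ' hne)
  have h2 := LinearMap.finrank_range_add_finrank_ker (D.cornerDifference σ)
  have h3 := LinearMap.finrank_range_add_finrank_ker (D.cornerDifference σ')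
  have h4 := finrank_ker_cornerDifference_le hσ
  have h5 := finrank_ker_cornerDifference_le hσ'
  rw [Module.finrank_fintype_fun_eq_card] at h2 h3
  rw [numCrossings_eq, numLoops, numLoops, Nat.card_eq_fintype_card, Nat.card_eq_fintype_card]
  omega

end DualState

/-! ### Nonvanishing and the span bound -/

theorem stateSum_ne_zero (D : LinkDiagram) : D.stateSum ≠ 0 := by
  intro h0
  -- At $A=1$ each state has the positive weight $2^{|s|}$; no signs occur in the positive bracket.
  have h := congrArg (LaurentPolynomial.eval₂ (RingHom.id ℤ) 1) h0
  rw [map_zero, stateSum, map_sum] at h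
  obtain ⟨τ, hτ, -⟩ := exists_isState_allA D
  refine (Finset.sum_pos (fun σ _ => ?_) ⟨τ, mem_states.2 hτ⟩).ne' h
  simp only [weight, map_mul, map_pow, map_add, LaurentPolynomial.eval₂_T]
  simp

theorem totalSpan_stateSum_le (D : LinkDiagram) :
    D.stateSum.totalSpan ≤ 4 * ((D.numCrossings : ℤ) + D.numComponents) := by
  obtain ⟨σ, hσ, hA⟩ := exists_isState_allA D
  obtain ⟨σ', hσ', hB⟩ := exists_isState_allB D
  have hdual := numLoops_add_numLoops_le hσ hσ' fun d hd h => by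
    have h1 := hA d hd
    have h2 := hB d hd
    rw [h, ← h2] at h1
    tauto
  have hE : D.stateSum.ExponentsIn (-D.numCrossings - 2 * D.numLoops σ')
      (D.numCrossings + 2 * D.numLoops σ) := by
    refine ExponentsIn.sum fun τ hτ => ?_
    rw [mem_states] at hτ
    have h1 := numLoops_le_allA hτ hσ hA
    have h2 := numLoops_le_allB hτ hσ' hB
    have h3 := numA_add_numB_le τ
    refine ((exponentsIn_T _).mul (exponentsIn_loop_pow _)).mono ?_ ?_ <;> omega
  have := hE.totalSpan_le D.stateSum_ne_zero
  omega

end LinkDiagram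

namespace LinkDiagram

open Classical LaurentPolynomial

variable {D : LinkDiagram}

/-! ### Every crossing can be smoothed -/

section SmoothingExists

/-- The rotation after smoothing the crossing of `e`. -/
noncomputable def smoothRot (D : LinkDiagram) (e : D.Dart) : Equiv.Perm D.Dart :=
  -- The transposition cuts the 4-cycle of `rot` into the 2-cycles on `e`, `rot³ e` and on `rot e`,
  -- `rot² e`.
  (Equiv.swap e (D.rot (D.rot e))).trans D.rot

theorem smoothRot_of_ne {e d : D.Dart} (h1 : d ≠ e) (h2 : d ≠ D.rot (D.rot e)) :
    D.smoothRot e d = D.rot d := by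
  simp [smoothRot, Equiv.swap_apply_of_ne_of_ne h1 h2]

theorem smoothRot_self (e : D.Dart) : D.smoothRot e e = D.rot (D.rot (D.rot e)) := by
  simp [smoothRot]

theorem smoothRot_rot_rot (e : D.Dart) : D.smoothRot e (D.rot (D.rot e)) = D.rot e := by
  simp [smoothRot]

theorem smoothRot_rot {e : D.Dart} (he : D.AtCrossing e) :
    D.smoothRot e (D.rot e) = D.rot (D.rot e) :=
  smoothRot_of_ne he.distinct.1.symm he.distinct.2.2.2.1

theorem smoothRot_rot_rot_rot {e : D.Dart} (he : D.AtCrossing e) :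
    D.smoothRot e (D.rot (D.rot (D.rot e))) = e := by
  rw [smoothRot_of_ne he.distinct.2.2.1.symm he.distinct.2.2.2.2.2.symm, D.rot_four]

theorem smoothRot_of_not_ofVertex {e d : D.Dart} (h : ¬ D.OfVertex e d) :
    D.smoothRot e d = D.rot d := by
  simp only [OfVertex, not_or] at h
  exact smoothRot_of_ne h.1 h.2.2.1

theorem smoothRot_smoothRot {e : D.Dart} (he : D.AtCrossing e) {d : D.Dart}
    (h : D.OfVertex e d) : D.smoothRot e (D.smoothRot e d) = d := by
  rcases h with rfl | rfl | rfl | rfl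
  · rw [smoothRot_self, smoothRot_rot_rot_rot he]
  · rw [smoothRot_rot he, smoothRot_rot_rot]
  · rw [smoothRot_rot_rot, smoothRot_rot he]
  · rw [smoothRot_rot_rot_rot he, smoothRot_self]

theorem smoothRot_region_face {e : D.Dart} {R' : Type*} {q : D.Region → R'}
    (hq : q (D.region e) = q (D.region (D.rot (D.rot e)))) (d : D.Dart) :
    q (D.region (D.opp (D.smoothRot e d))) = q (D.region d) := by
  by_cases h1 : d = e
  · rw [h1, smoothRot_self, D.region_face, hq]
  by_cases h2 : d = D.rot (D.rot e)
  · rw [h2, smoothRot_rot_rot, D.region_face, hq]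
  · rw [smoothRot_of_ne h1 h2, D.region_face]

/-- If a smoothing disconnects the two joining arcs, then the two joined corners lie in the same
region. -/
theorem region_eq_of_smoothRot_disconnected {e : D.Dart}
    (h : ¬ Relation.EqvGen (fun a b => b = D.smoothRot e a ∨ b = D.opp a) e (D.rot e)) :
    D.region e = D.region (D.rot (D.rot e)) := by
  set R := Relation.EqvGen (fun a b => b = D.smoothRot e a ∨ b = D.opp a)
  let φ : Equiv.Perm D.Dart := D.rot.trans D.opp
  have hφ : ∀ n : ℕ, D.region ((φ ^ n) e) = D.region e := by
    intro n
    induction n with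
    | zero => rfl
    | succ n ih =>
      rw [pow_succ', Equiv.Perm.mul_apply, ← ih]
      exact D.region_face _
  -- The walk along the face boundary from `e` stays in one region. If it misses `rot² e`, then
  -- after its first step it follows the smoothed graph until it returns to `e`, so it connects `rot
  -- e` to `e`.
  by_cases hn : ∃ n : ℕ, (φ ^ n) e = D.rot (D.rot e)
  · obtain ⟨n, hn⟩ := hn
    rw [← hn, hφ]
  · exfalso
    have hB : ∀ n : ℕ, R (D.rot e) ((φ ^ (n + 1)) e) := by
      intro n
      induction n with
      | zero => exact .rel _ _ (Or.inr rfl)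
      | succ n ih =>
        rw [pow_succ', Equiv.Perm.mul_apply]
        set x := (φ ^ (n + 1)) e
        have h1 : x ≠ e := fun h1 => h (h1 ▸ ih).symm
        have h2 : x ≠ D.rot (D.rot e) := fun h2 => hn ⟨_, h2⟩
        have h3 : R x (D.rot x) := .rel _ _ (Or.inl (smoothRot_of_ne h1 h2).symm)
        exact .trans _ _ _ ih (.trans _ _ _ h3 (.rel _ _ (Or.inr rfl)))
    have hpos := orderOf_pos φ
    have := hB (orderOf φ - 1)
    rw [Nat.sub_add_cancel hpos, pow_orderOf_eq_one] at this
    exact h this.symm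

/-- The regions after joining the regions of two opposite corners. -/
def SmoothRegion (D : LinkDiagram) (e : D.Dart) : Type :=
  Quot fun r s => r = D.region e ∧ s = D.region (D.rot (D.rot e))

theorem card_region_le (e : D.Dart) : Nat.card D.Region ≤ Nat.card (D.SmoothRegion e) + 1 := by
  have h := card_quot_le_card_quot_or_pair (fun _ _ : D.Region => False) (D.region e)
    (D.region (D.rot (D.rot e)))
  simp only [false_or] at h
  refine le_trans (Nat.card_le_card_of_surjective (Quot.lift id fun _ _ h => h.elim) ?_) h
  exact fun r => ⟨Quot.mk _ r, rfl⟩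

theorem card_region_le_of_eq {e : D.Dart} (h : D.region e = D.region (D.rot (D.rot e))) :
    Nat.card D.Region ≤ Nat.card (D.SmoothRegion e) := by
  have : Finite (D.SmoothRegion e) := inferInstanceAs (Finite (Quot _))
  refine Nat.card_le_card_of_surjective
    (Quot.lift id (by rintro _ _ ⟨rfl, rfl⟩; exact h) : D.SmoothRegion e → D.Region) ?_
  exact fun r => ⟨Quot.mk _ r, rfl⟩

theorem card_vertex_lt {e : D.Dart} (he : D.AtCrossing e) :
    Nat.card D.Vertex + 1 ≤ Nat.card (Quot fun a b => b = D.smoothRot e a) := by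
  refine le_trans (Nat.add_le_add_right ?_ 1)
    (card_quot_or_pair_lt (fun a b => b = D.smoothRot e a) (a := e) (b := D.rot e) fun h => ?_)
  · refine card_quot_le_of_eqvGen ?_
    have hv : ∀ a b, D.OfVertex a b → Relation.EqvGen (fun a b => b = D.rot a) a b :=
      fun a b h => Quot.eqvGen_exact (D.vertex_mk_eq_iff.2 h)
    rintro a b (rfl | ⟨rfl, rfl⟩)
    · by_cases h1 : a = e
      · rw [h1, smoothRot_self]
        exact hv _ _ (Or.inr (Or.inr (Or.inr rfl)))
      by_cases h2 : a = D.rot (D.rot e)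
      · rw [h2, smoothRot_rot_rot]
        exact (hv _ _ (Or.inr (Or.inl rfl))).symm
      · rw [smoothRot_of_ne h1 h2]
        exact .rel _ _ rfl
    · exact .rel _ _ rfl
  -- The pair `e`, `rot³ e` is a full orbit of `smoothRot` and does not contain `rot e`.
  · have key : ∀ a b, Relation.EqvGen (fun a b => b = D.smoothRot e a) a b →
        ((a = e ∨ a = D.rot (D.rot (D.rot e))) ↔ (b = e ∨ b = D.rot (D.rot (D.rot e)))) := by
      intro a b hab
      induction hab with
      | rel a b hab =>
        rw [hab, ← smoothRot_self, (D.smoothRot e).injective.eq_iff]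
        have h3 : D.smoothRot e a = e ↔ a = D.smoothRot e e := by
          rw [← (D.smoothRot e).injective.eq_iff (a := a), smoothRot_self,
            smoothRot_rot_rot_rot he]
        rw [h3, or_comm]
      | refl => rfl
      | symm _ _ _ ih => exact ih.symm
      | trans _ _ _ _ _ ih1 ih2 => exact ih1.trans ih2
    obtain ⟨d1, d2, d3, d4, d5, d6⟩ := he.distinct
    rcases (key _ _ h).1 (Or.inl rfl) with h | h
    · exact d1 h.symm
    · exact d5 h

theorem equivalence_rot_of_smoothRot {e : D.Dart} (he : D.AtCrossing e)
    {R : D.Dart → D.Dart → Prop} (hR : Equivalence R) (h1 : ∀ d, R d (D.smoothRot e d))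
    (h2 : R e (D.rot e)) (d : D.Dart) : R d (D.rot d) := by
  by_cases hd : d = e
  · rwa [hd]
  by_cases hd' : d = D.rot (D.rot e)
  · have h3 := h1 e
    have h4 := h1 (D.rot e)
    rw [smoothRot_self] at h3
    rw [smoothRot_rot he] at h4
    rw [hd']
    exact hR.trans (hR.symm h4) (hR.trans (hR.symm h2) h3)
  · rw [← smoothRot_of_ne hd hd']
    exact h1 d

theorem card_smooth_component_le {e : D.Dart} (he : D.AtCrossing e) :
    Nat.card (Quot fun a b => b = D.smoothRot e a ∨ b = D.opp a) ≤ Nat.card D.Component + 1 := by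
  refine (card_quot_le_card_quot_or_pair _ e (D.rot e)).trans (Nat.add_le_add_right ?_ 1)
  refine card_quot_le_of_eqvGen ?_
  rintro a b (rfl | rfl)
  · exact equivalence_rot_of_smoothRot he (Relation.EqvGen.is_equivalence _)
      (fun d => .rel _ _ (Or.inl (Or.inl rfl))) (.rel _ _ (Or.inr ⟨rfl, rfl⟩)) a
  · exact .rel _ _ (Or.inl (Or.inr rfl))

theorem card_smooth_component_le_of_connected {e : D.Dart} (he : D.AtCrossing e)
    (h : Relation.EqvGen (fun a b => b = D.smoothRot e a ∨ b = D.opp a) e (D.rot e)) :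
    Nat.card (Quot fun a b => b = D.smoothRot e a ∨ b = D.opp a) ≤ Nat.card D.Component := by
  refine card_quot_le_of_eqvGen ?_
  rintro a b (rfl | rfl)
  · exact equivalence_rot_of_smoothRot he (Relation.EqvGen.is_equivalence _)
      (fun d => .rel _ _ (Or.inl rfl)) h a
  · exact .rel _ _ (Or.inr rfl)

theorem reflTransGen_smooth (e : D.Dart) (r s : D.SmoothRegion e) :
    Relation.ReflTransGen (fun r s : D.SmoothRegion e =>
      ∃ d, Quot.mk _ (D.region d) = r ∧ Quot.mk _ (D.region (D.opp d)) = s) r s := by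
  obtain ⟨r, rfl⟩ := Quot.exists_rep r
  obtain ⟨s, rfl⟩ := Quot.exists_rep s
  induction D.connected r s with
  | refl => exact .refl
  | tail _ h ih =>
    obtain ⟨d, rfl, rfl⟩ := h
    exact ih.tail ⟨d, rfl, rfl⟩

/-- The diagram in which the crossing of `e` is smoothed. -/
noncomputable def smooth (D : LinkDiagram) (e : D.Dart) (he : D.AtCrossing e) : LinkDiagram where
  Dart := D.Dart
  finite_dart := D.finite_dart
  rot := D.smoothRot e
  opp := D.opp
  rot_ne d := by
    by_cases h1 : d = e
    · rw [h1, smoothRot_self]; exact he.distinct.2.2.1.symm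
    by_cases h2 : d = D.rot (D.rot e)
    · rw [h2, smoothRot_rot_rot]; exact he.distinct.2.2.2.1
    · rw [smoothRot_of_ne h1 h2]; exact D.rot_ne d
  rot_four d := by
    by_cases h : D.OfVertex e d
    · rw [smoothRot_smoothRot he h, smoothRot_smoothRot he h]
    · have h1 := mt D.ofVertex_rot.1 h
      have h2 := mt D.ofVertex_rot.1 h1
      have h3 := mt D.ofVertex_rot.1 h2
      rw [smoothRot_of_not_ofVertex h, smoothRot_of_not_ofVertex h1, smoothRot_of_not_ofVertex h2,
        smoothRot_of_not_ofVertex h3, D.rot_four]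
  opp_ne := D.opp_ne
  opp_opp := D.opp_opp
  overDarts := D.overDarts
  overDarts_rot d hd := by
    have h : ¬ D.OfVertex e d := fun h => hd (smoothRot_smoothRot he h)
    have h1 := mt D.ofVertex_rot.1 h
    rw [smoothRot_of_not_ofVertex h, smoothRot_of_not_ofVertex h1] at hd
    rw [smoothRot_of_not_ofVertex h]
    exact D.overDarts_rot d hd
  Region := D.SmoothRegion e
  finite_region := inferInstanceAs (Finite (Quot _))
  outer := Quot.mk _ D.outer
  region d := Quot.mk _ (D.region d)
  region_face := smoothRot_region_face (Quot.sound ⟨rfl, rfl⟩)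
  connected := reflTransGen_smooth e
  euler := by
    have : Finite (D.SmoothRegion e) := inferInstanceAs (Finite (Quot _))
    have h1 := euler_inequality (D.smoothRot e) D.opp D.opp_opp
      (Quot.mk _ D.outer : D.SmoothRegion e) (fun d => Quot.mk _ (D.region d))
      (smoothRot_region_face (Quot.sound ⟨rfl, rfl⟩)) (reflTransGen_smooth e)
    have h2 := card_vertex_lt he
    have h3 := D.euler
    change Nat.card D.Vertex + _ = _ + Nat.card D.Component + 1 at h3
    refine le_antisymm h1 ?_
    -- The new vertex pays either for a lost region or for a new component. Both cannot happen: if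
    -- the arcs get disconnected, the joined corners already shared a region.
    by_cases hc : Relation.EqvGen (fun a b => b = D.smoothRot e a ∨ b = D.opp a) e (D.rot e)
    · have h4 := card_smooth_component_le_of_connected he hc
      have h5 := card_region_le e
      omega
    · have h4 := card_smooth_component_le he
      have h5 := card_region_le_of_eq (region_eq_of_smoothRot_disconnected hc)
      omega

theorem isSmoothing_smooth (e : D.Dart) (he : D.AtCrossing e) :
    IsSmoothing D (D.smooth e he) e := by
  refine ⟨he, Equiv.refl _, Quot.mk _, fun d => rfl, smoothRot_self e, smoothRot_rot_rot_rot he,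
    smoothRot_rot he, smoothRot_rot_rot e, ?_, fun d => rfl, rfl, Quot.mk_surjective, ?_⟩
  · exact fun d h0 _ h2 _ => ⟨smoothRot_of_ne h0 h2, fun _ => Iff.rfl⟩
  · intro r s
    constructor
    · intro h
      have h' := Quot.eqvGen_exact h
      clear h
      induction h' with
      | rel x y h => exact Or.inr (Or.inl h)
      | refl => exact Or.inl rfl
      | symm x y _ ih =>
        rcases ih with h | h | h
        · exact Or.inl h.symm
        · exact Or.inr (Or.inr h.symm)
        · exact Or.inr (Or.inl h.symm)
      | trans x y z _ _ ih1 ih2 => grind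
    · rintro (rfl | h | h)
      · rfl
      · exact Quot.sound h
      · exact (Quot.sound (r := fun r s => r = D.region e ∧ s = D.region (D.rot (D.rot e)))
          ⟨h.2, h.1⟩).symm

end SmoothingExists

/-! ### Every nonempty crossingless diagram has a removable loop -/

section LoopRemovalExists

/-- In a crossingless diagram the two sides of a half-edge depend only on its component. -/
theorem sides_eq (hD : ∀ d, ¬ D.AtCrossing d) {a b : D.Dart}
    (h : Relation.EqvGen (fun a b => b = D.rot a ∨ b = D.opp a) a b) :
    (D.region a = D.region b ∧ D.region (D.rot a) = D.region (D.rot b)) ∨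
      (D.region a = D.region (D.rot b) ∧ D.region (D.rot a) = D.region b) := by
  have hr : ∀ d, D.rot (D.rot d) = d := fun d => not_not.1 (hD d)
  have h1 : ∀ d, D.region (D.opp d) = D.region (D.rot d) := fun d => by
    rw [← D.region_face (D.rot d), hr]
  have h2 : ∀ d, D.region (D.rot (D.opp d)) = D.region d := fun d => by
    rw [← h1, D.opp_opp]
  induction h with
  | rel a b h =>
    rcases h with rfl | rfl
    · exact Or.inr ⟨by rw [hr], rfl⟩
    · exact Or.inr ⟨(h2 a).symm, (h1 a).symm⟩
  | refl => exact Or.inl ⟨rfl, rfl⟩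
  | symm _ _ _ ih => grind
  | trans _ _ _ _ _ ih1 ih2 => grind

theorem region_opp_eq_region_rot (hD : ∀ d, ¬ D.AtCrossing d) (d : D.Dart) :
    D.region (D.opp d) = D.region (D.rot d) := by
  rw [← D.region_face (D.rot d), not_not.1 (hD d)]

/-- Vertices and edges both number half the darts, so they cancel in Euler's formula. -/
theorem card_region_eq (hD : ∀ d, ¬ D.AtCrossing d) :
    Nat.card D.Region = Nat.card D.Component + 1 := by
  have h1 := two_mul_card_quot_involution D.rot (fun d => not_not.1 (hD d)) D.rot_ne
  have h2 := two_mul_card_quot_involution D.opp D.opp_opp D.opp_ne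
  have h3 := D.euler
  change _ = _ + Nat.card D.Component + 1 at h3
  omega

/-- In a nonempty crossingless diagram some region other than the outer one is bounded by a single
loop. -/
theorem exists_leaf_region (hD : ∀ d, ¬ D.AtCrossing d) [Nonempty D.Dart] :
    ∃ (r : D.Region) (K : D.Component) (r' : D.Region), r ≠ D.outer ∧ r' ≠ r ∧
      (∀ d, D.region d = r → Quot.mk _ d = K) ∧
      ∀ d, Quot.mk _ d = K → (D.region d = r ∧ D.region (D.opp d) = r') ∨
        (D.region d = r' ∧ D.region (D.opp d) = r) := by
  have := Fintype.ofFinite D.Component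
  have hR := card_region_eq hD
  rw [Nat.card_eq_fintype_card, Nat.card_eq_fintype_card] at hR
  have hC : 0 < Fintype.card D.Component :=
    Fintype.card_pos_iff.2 ⟨Quot.mk _ (Classical.arbitrary D.Dart)⟩
  -- The region on each of the two sides of a loop.
  let s : D.Component × Bool → D.Region := fun p =>
    if p.2 then D.region p.1.out else D.region (D.rot p.1.out)
  have hs : ∀ d : D.Dart, ∃ b, D.region d = s (Quot.mk _ d, b) ∧
      D.region (D.opp d) = s (Quot.mk _ d, !b) := by
    intro d
    have h := sides_eq hD (Quot.eqvGen_exact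
      (Quot.out_eq (Quot.mk _ d : D.Component)).symm)
    rw [region_opp_eq_region_rot hD]
    rcases h with h | h
    · exact ⟨true, by simpa [s] using h⟩
    · exact ⟨false, by simpa [s] using h⟩
  have hne : ∀ r : D.Region, ∃ p, s p = r := by
    intro r
    obtain ⟨t, ht⟩ := Fintype.exists_ne_of_one_lt_card (by omega) r
    rcases (D.connected r t).cases_head with h | ⟨u, ⟨d, hd, -⟩, -⟩
    · exact absurd h.symm ht
    · obtain ⟨b, hb, -⟩ := hs d
      exact ⟨_, hb.symm.trans hd⟩
  -- With $C$ loops there are $2C$ sides and $C+1$ regions. One side at the outer region and two at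
  -- every other would require $2C+1$ sides.
  have hex : ∃ r ≠ D.outer, (Finset.univ.filter fun p => s p = r).card < 2 := by
    by_contra! hall
    have h1 : (Finset.univ : Finset (D.Component × Bool)).card =
        ∑ r : D.Region, (Finset.univ.filter fun p => s p = r).card :=
      Finset.card_eq_sum_card_fiberwise fun _ _ => Finset.mem_coe.2 (Finset.mem_univ _)
    have h2 : ∑ r : D.Region, (if r = D.outer then 1 else 2) ≤
        ∑ r : D.Region, (Finset.univ.filter fun p => s p = r).card := by
      refine Finset.sum_le_sum fun r _ => ?_
      split_ifs with hr
      · obtain ⟨p, hp⟩ := hne r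
        exact Finset.card_pos.2 ⟨p, by simp [hp]⟩
      · exact hall r hr
    have h3 : ∑ r : D.Region, (if r = D.outer then 1 else 2) + 1 = 2 * Fintype.card D.Region := by
      rw [← Finset.add_sum_erase _ _ (Finset.mem_univ D.outer), if_pos rfl,
        Finset.sum_congr rfl fun r hr => if_neg (Finset.ne_of_mem_erase hr), Finset.sum_const,
        Finset.card_erase_of_mem (Finset.mem_univ _), Finset.card_univ, smul_eq_mul]
      omega
    rw [Finset.card_univ, Fintype.card_prod, Fintype.card_bool] at h1
    omega
  obtain ⟨r, hr, hlt⟩ := hex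
  obtain ⟨p, hp⟩ := hne r
  have hone : ∀ p', s p' = r → p' = p := fun p' hp' =>
    Finset.card_le_one.1 (Nat.le_of_lt_succ hlt) p' (by simp [hp']) p (by simp [hp])
  refine ⟨r, p.1, s (p.1, !p.2), hr, fun h => ?_, fun d hd => ?_, fun d hd => ?_⟩
  · have := congrArg Prod.snd (hone _ h)
    simp at this
  · obtain ⟨b, hb, -⟩ := hs d
    exact congrArg Prod.fst (hone _ (hb.symm.trans hd))
  · obtain ⟨b, h1, h2⟩ := hs d
    rw [h1, h2, hd]
    by_cases hb : b = p.2
    · left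
      rw [hb]
      exact ⟨hp, rfl⟩
    · right
      have : (!b) = p.2 := by cases b <;> cases h : p.2 <;> simp_all
      rw [← this, Bool.not_not]
      exact ⟨rfl, by rw [this]; exact hp⟩

theorem exists_isLoopRemoval (hD : ∀ d, ¬ D.AtCrossing d) [Nonempty D.Dart] :
    ∃ D', IsLoopRemoval D D' := by
  obtain ⟨r, K, r', hr, hr', h1, h2⟩ := exists_leaf_region hD
  have hrr : ∀ d, D.rot (D.rot d) = d := fun d => not_not.1 (hD d)
  have hrot : ∀ d, (Quot.mk _ (D.rot d) : D.Component) = Quot.mk _ d := fun d =>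
    (Quot.sound (r := fun a b => b = D.rot a ∨ b = D.opp a) (Or.inl rfl)).symm
  have hopp : ∀ d, (Quot.mk _ (D.opp d) : D.Component) = Quot.mk _ d := fun d =>
    (Quot.sound (r := fun a b => b = D.rot a ∨ b = D.opp a) (Or.inr rfl)).symm
  let rot' : Equiv.Perm {d : D.Dart // (Quot.mk _ d : D.Component) ≠ K} :=
    D.rot.subtypePerm fun d => by rw [hrot]
  let opp' : Equiv.Perm {d : D.Dart // (Quot.mk _ d : D.Component) ≠ K} :=
    D.opp.subtypePerm fun d => by rw [hopp]
  have hrange : ∀ d, d ∉ Set.range (Subtype.val :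
      {d : D.Dart // (Quot.mk _ d : D.Component) ≠ K} → D.Dart) ↔ Quot.mk _ d = K := by
    intro d
    exact ⟨fun h => by_contra fun h' => h ⟨⟨d, h'⟩, rfl⟩, fun h ⟨x, hx⟩ => x.2 (hx ▸ h)⟩
  have hrot' : ∀ d, rot' (rot' d) = d := fun d => Subtype.ext (hrr d.1)
  have hopp' : ∀ d, opp' (opp' d) = d := fun d => Subtype.ext (D.opp_opp d.1)
  have hrne : ∀ d, rot' d ≠ d := fun d h => D.rot_ne d.1 (congrArg Subtype.val h)
  have hone : ∀ d, opp' d ≠ d := fun d h => D.opp_ne d.1 (congrArg Subtype.val h)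
  have hcomp : Nat.card D.Component =
      Nat.card (Quot fun a b => b = rot' a ∨ b = opp' a) + 1 := by
    obtain ⟨k, hk⟩ := Quot.exists_rep K
    refine card_quot_eq_card_quot_add_one Subtype.val_injective (fun x y => ?_) ?_
      ((hrange k).2 hk) fun x hx => ?_
    · rw [Subtype.ext_iff, Subtype.ext_iff]
      rfl
    · rintro x y h
      have hxy : (Quot.mk _ x : D.Component) = Quot.mk _ y := Quot.sound h
      rw [← not_iff_not, hrange, hrange, hxy]
    · exact Quot.eqvGen_exact (hk.trans ((hrange x).1 hx).symm)
  have hreg : Nat.card D.Region = Nat.card {s : D.Region // s ≠ r} + 1 := by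
    rw [← Finite.card_option]
    exact (Nat.card_congr (Equiv.optionSubtypeNe r)).symm
  let D' : LinkDiagram :=
    { Dart := {d : D.Dart // (Quot.mk _ d : D.Component) ≠ K}
      finite_dart := inferInstance
      rot := rot'
      opp := opp'
      rot_ne := hrne
      rot_four := fun d => by rw [hrot', hrot']
      opp_ne := hone
      opp_opp := hopp'
      overDarts := ∅
      overDarts_rot := fun d hd => absurd (hrot' d) hd
      Region := {s : D.Region // s ≠ r}
      finite_region := inferInstance
      outer := ⟨D.outer, hr.symm⟩
      region := fun d => ⟨D.region d.1, fun h => d.2 (h1 d.1 h)⟩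
      region_face := fun d => Subtype.ext (D.region_face d.1)
      connected := by
        -- Replacing `r` by its only neighbour `r'` turns a walk between regions into one that
        -- avoids the deleted loop.
        have hr'' : ∀ s t, Relation.ReflTransGen
            (fun s t => ∃ d, D.region d = s ∧ D.region (D.opp d) = t) s t →
            Relation.ReflTransGen (fun s t : {s : D.Region // s ≠ r} =>
              ∃ d : {d : D.Dart // (Quot.mk _ d : D.Component) ≠ K},
                (⟨D.region d.1, fun h => d.2 (h1 d.1 h)⟩ : {s : D.Region // s ≠ r}) = s ∧
                (⟨D.region (opp' d).1, fun h => (opp' d).2 (h1 _ h)⟩ :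
                  {s : D.Region // s ≠ r}) = t)
              (if h : s = r then ⟨r', hr'⟩ else ⟨s, h⟩)
              (if h : t = r then ⟨r', hr'⟩ else ⟨t, h⟩) := by
          intro s t hst
          induction hst with
          | refl => exact .refl
          | tail _ hst ih =>
            refine ih.trans ?_
            obtain ⟨d, rfl, rfl⟩ := hst
            by_cases hd : (Quot.mk _ d : D.Component) = K
            · rcases h2 d hd with ⟨e1, e2⟩ | ⟨e1, e2⟩ <;> simp only [e1, e2, hr', dite_true,
                dite_false] <;> exact .refl
            · have e1 : D.region d ≠ r := fun h => hd (h1 d h)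
              have e2 : D.region (D.opp d) ≠ r := fun h => hd (by rw [← h1 _ h, hopp])
              simp only [e1, e2, dite_false]
              exact .single ⟨⟨d, hd⟩, rfl, rfl⟩
        rintro ⟨s, hs⟩ ⟨t, ht⟩
        have := hr'' s t (D.connected s t)
        simpa only [hs, ht, dite_false] using this
      euler := by
        have e1 := two_mul_card_quot_involution rot' hrot' hrne
        have e2 := two_mul_card_quot_involution opp' hopp' hone
        have e3 := card_region_eq hD
        omega }
  refine ⟨D', Subtype.val, Subtype.val, Subtype.val_injective, Subtype.val_injective,
    fun d => rfl, fun d => rfl, fun d hd => absurd (hrot' d) hd, fun d => rfl, rfl,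
    ⟨K, hrange⟩, fun d _ => hD d, r, ?_, fun s hs => ?_⟩
  · rintro ⟨s, hs⟩
    exact s.2 hs
  · by_contra h
    exact hs ⟨⟨s, h⟩, rfl⟩

end LoopRemovalExists

/-! ### Uniqueness of the bracket -/

theorem RotSmoothing.card_lt {D' : LinkDiagram} {e : D.Dart} {f : D.Dart ≃ D'.Dart}
    (h : RotSmoothing D D' e f) :
    Nat.card D'.Dart + {d | D'.AtCrossing d}.ncard < Nat.card D.Dart + {d | D.AtCrossing d}.ncard := by
  rw [Nat.card_congr f]
  refine Nat.add_lt_add_left ?_ _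
  have : {d | D'.AtCrossing d} = f '' {d | D.AtCrossing d ∧ ¬ D.OfVertex e d} := by
    ext x
    obtain ⟨d, rfl⟩ := f.surjective x
    rw [f.injective.mem_set_image]
    exact h.atCrossing_iff d
  rw [this, Set.ncard_image_of_injective _ f.injective]
  refine Set.ncard_lt_ncard ((Set.ssubset_iff_of_subset fun d hd => hd.1).2 ?_)
  exact ⟨e, h.atCrossing, fun h' => h'.2 (Or.inl rfl)⟩

/-- The defining rules determine the bracket. -/
theorem IsPositiveBracket.unique {P Q : LinkDiagram → LaurentPolynomial ℤ}
    (hP : IsPositiveBracket P) (hQ : IsPositiveBracket Q) (D : LinkDiagram) : P D = Q D := by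
  -- Smoothing keeps the darts but loses crossing darts; deleting a loop loses darts and creates no
  -- crossing darts.
  induction hn : Nat.card D.Dart + {d | D.AtCrossing d}.ncard using Nat.strong_induction_on
    generalizing D with
  | _ n ih =>
    subst hn
    by_cases hD : ∃ d, D.AtCrossing d
    · obtain ⟨e, he, heo⟩ : ∃ e, D.AtCrossing e ∧ e ∈ D.overDarts := by
        obtain ⟨d, hd⟩ := hD
        by_cases ho : d ∈ D.overDarts
        · exact ⟨d, hd, ho⟩
        · exact ⟨D.rot d, D.atCrossing_rot.2 hd, (D.overDarts_rot d hd).2 ho⟩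
      have hA := isSmoothing_smooth e he
      have hB := isSmoothing_smooth (D.rot e) (D.atCrossing_rot.2 he)
      rw [hP.crossing _ _ _ e heo hA hB, hQ.crossing _ _ _ e heo hA hB]
      obtain ⟨f, hf⟩ := hA.exists_rotSmoothing
      obtain ⟨g, hg⟩ := hB.exists_rotSmoothing
      rw [ih _ hf.card_lt _ rfl, ih _ hg.card_lt _ rfl]
    · rw [not_exists] at hD
      rcases isEmpty_or_nonempty D.Dart with hE | hE
      · rw [hP.empty D hE, hQ.empty D hE]
      · obtain ⟨D', hD'⟩ := exists_isLoopRemoval hD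
        rw [hP.loop _ _ hD', hQ.loop _ _ hD']
        obtain ⟨i, hi⟩ := hD'.exists_dartRemoval
        congr 1
        refine ih _ (Nat.add_lt_add_of_lt_of_le ?_ ?_) _ rfl
        · obtain ⟨K, hK⟩ := hi.component
          obtain ⟨k, hk⟩ := Quot.exists_rep K
          rw [Nat.card_eq_fintype_card, Nat.card_eq_fintype_card]
          exact Fintype.card_lt_of_injective_of_notMem i hi.inj ((hK k).2 hk)
        · rw [← Set.ncard_image_of_injective _ hi.inj]
          refine Set.ncard_le_ncard ?_
          rintro _ ⟨d, hd, rfl⟩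
          exact (hi.atCrossing_iff d).2 hd

end LinkDiagram

theorem mainTheorem4 :
    (∃! P : LinkDiagram → LaurentPolynomial ℤ, LinkDiagram.IsPositiveBracket P) ∧
    ∀ P : LinkDiagram → LaurentPolynomial ℤ, LinkDiagram.IsPositiveBracket P →
      ∀ T : LinkDiagram, P T ≠ 0 ∧
        (P T).totalSpan ≤ 4 * ((T.numCrossings : ℤ) + (T.numComponents : ℤ)) := by
  refine ⟨⟨LinkDiagram.stateSum, LinkDiagram.isPositiveBracket_stateSum, fun P hP => funext fun D =>
    hP.unique LinkDiagram.isPositiveBracket_stateSum D⟩, fun P hP D => ?_⟩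
  rw [hP.unique LinkDiagram.isPositiveBracket_stateSum D]
  exact ⟨D.stateSum_ne_zero, D.totalSpan_stateSum_le⟩
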